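/- Let $K$ be a field, $Q$ a finite quiver, and $A=KQ/I$ a finite dimensional almost gentle algebra, i.e. $I$ is an admissible ideal of the path algebra $KQ$ generated by paths of length $2$, and for every arrow $a$ of $Q$ there is at most one arrow $b$ with $ab\notin I$ and at most one arrow $c$ with $ca\notin I$ (here $ab$ means $a$ followed by $b$). Let $\mathcal M$ be the set of maximal paths of $A$, i.e. paths $m\notin I$ with $am\in I$ and $ma\in I$ for all arrows $a$. Let $T(A)=A\ltimes D(A)$, $D(A)=\operatorname{Hom}_K(A,K)$, be the trivial extension, with product $(a,f)(b,g)=(ab,ag+fb)$, where $(afb)(x)=f(bxa)$. Let $Q_{T(A)}$ be the quiver with the vertices of $Q$ and the arrows of $Q$ together with one new arrow $\beta_m$ from the end of $m$ to the start of $m$ for each $m\in\mathcal M$. Let $\mathcal S$ be the set of special cycles, i.e. of all cyclic permutations of the cycles $m\beta_m$ ($m\in\mathcal M$), and let $D=\{\beta_m\mid m\in\mathcal M\}$. Then: 1. If $Q$ has no isolated vertex, then $(\mathcal S,\mu\equiv1)$ is a defining pair in $Q_{T(A)}$: $\mathcal S$ consists of cycles without repeated arrows, contains no loop (a cycle of length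 one), is closed under cyclic permutation, every arrow lies on a cycle in $\mathcal S$, and any two cycles in $\mathcal S$ with a common arrow are cyclic permutations of each other. 2. There is a surjective $K$-algebra homomorphism $\varphi\colon KQ_{T(A)}\to T(A)$ with $\varphi(e_v)=(e_v,0)$ for every vertex $v$, $\varphi(a)=(a,0)$ for every arrow $a$ of $Q$, and $\varphi(\beta_m)=(0,m^\vee)$ for every $m\in\mathcal M$, where $m^\vee(m)=1$ and $m^\vee(p)=0$ for every other path $p\notin I$. Its kernel $I_{T(A)}$ is admissible, and it is the ideal generated by the elements $C-C'$ for $C,C'\in\mathcal S$ at the same vertex, $Ca$ for $C\in\mathcal S$ with first arrow $a$, and $ab$ for consecutive arrows $a,b$ such that $ab$ does not lie on any cycle in $\mathcal S$. So $T(A)=KQ_{T(A)}/I_{T(A)}$ is the algebra defined by the cycles $(\mathcal S,1)$. 3. $D$ is an admissible cut of $Q_{T(A)}$: every cycle in $\mathcal S$ contains exactly one arrow of $D$. 4. The cut algebra $KQ_{T(A)}/\langle I_{T(A)}\cup D\rangle$ associated to $D$ is isomorphic to $A$ as a $K$-algebra. -/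

import Mathlib

namespace AlmostGentle

open Quiver

universe u v w

section PathAlgebra

/-- The path algebra `KQ` of a quiver `Q` with vertex type `V`: the `K`-vector space with basis
the set of all paths of `Q` (including the trivial path at every vertex). -/
def PathAlgebra (K : Type w) (V : Type u) [Field K] [Quiver.{v} V] : Type (max u v w) :=
  (Σ a : V, Σ b : V, Path a b) →₀ K

variable {K : Type w} [Field K] {V : Type u} [Quiver.{v} V]

noncomputable instance : AddCommGroup (PathAlgebra K V) :=
  inferInstanceAs (AddCommGroup ((Σ a : V, Σ b : V, Path a b) →₀ K))

noncomputable instance : Module K (PathAlgebra K V) :=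
  inferInstanceAs (Module K ((Σ a : V, Σ b : V, Path a b) →₀ K))

variable (K) in
/-- A path, as an element of the path algebra. -/
noncomputable def ofPath {a b : V} (p : Path a b) : PathAlgebra K V :=
  Finsupp.single (⟨a, b, p⟩ : Σ a : V, Σ b : V, Path a b) (1 : K)

variable (K) in
open Classical in
/-- The product of two basis elements: the concatenation "`p` followed by `q`" if `p` ends where
`q` starts, and `0` otherwise. -/
noncomputable def pathMul (p q : Σ a : V, Σ b : V, Path a b) : PathAlgebra K V :=
  if h : q.1 = p.2.1 then ofPath K (p.2.2.comp (q.2.2.cast h rfl)) else 0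

variable (K V) in
/-- The bilinear extension of `pathMul`. -/
noncomputable def mulLin : PathAlgebra K V →ₗ[K] PathAlgebra K V →ₗ[K] PathAlgebra K V :=
  Finsupp.linearCombination K
    (fun p => (Finsupp.linearCombination K (pathMul K p) : PathAlgebra K V →ₗ[K] PathAlgebra K V))

noncomputable instance : Mul (PathAlgebra K V) := ⟨fun x y => mulLin K V x y⟩

theorem mul_def (x y : PathAlgebra K V) : x * y = mulLin K V x y := rfl

theorem ofPath_mul_ofPath {a b c : V} (p : Path a b) (q : Path b c) :
    ofPath K p * ofPath K q = ofPath K (p.comp q) := by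
  rw [mul_def, mulLin, ofPath, ofPath]
  erw [Finsupp.linearCombination_single, one_smul, Finsupp.linearCombination_single, one_smul]
  simp [pathMul]

theorem ofPath_mul_ofPath_of_ne {a b c d : V} (p : Path a b) (q : Path c d) (h : c ≠ b) :
    ofPath K p * ofPath K q = 0 := by
  rw [mul_def, mulLin, ofPath, ofPath]
  erw [Finsupp.linearCombination_single, one_smul, Finsupp.linearCombination_single, one_smul]
  simp [pathMul, h]

/-- Induction principle: the path algebra is spanned by paths. -/
theorem pathAlgebra_induction {P : PathAlgebra K V → Prop} (x : PathAlgebra K V)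
    (zero : P 0) (add : ∀ x y, P x → P y → P (x + y))
    (path : ∀ (r : K) (a b : V) (p : Path a b), P (r • ofPath K p)) : P x := by
  refine Finsupp.induction_linear (motive := P) x zero add fun p r => ?_
  have h := path r p.1 p.2.1 p.2.2
  have e : r • ofPath K p.2.2 = (Finsupp.single p r : PathAlgebra K V) := by
    unfold ofPath
    erw [Finsupp.smul_single, smul_eq_mul, mul_one]
  rwa [e] at h

theorem pathAlgebra_smul_mul (r : K) (x y : PathAlgebra K V) : r • x * y = r • (x * y) := by
  simp [mul_def]

theorem pathAlgebra_mul_smul (r : K) (x y : PathAlgebra K V) : x * r • y = r • (x * y) := by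
  simp [mul_def]

noncomputable instance : NonUnitalNonAssocRing (PathAlgebra K V) where
  left_distrib x y z := by simp [mul_def]
  right_distrib x y z := by simp [mul_def]
  zero_mul x := by simp [mul_def]
  mul_zero x := by simp [mul_def]

theorem pathAlgebra_mul_assoc (x y z : PathAlgebra K V) : x * y * z = x * (y * z) := by
  induction x using pathAlgebra_induction with
  | zero => simp
  | add x x' hx hx' => simp only [add_mul, hx, hx']
  | path r a b p =>
  induction y using pathAlgebra_induction with
  | zero => simp
  | add y y' hy hy' => simp only [add_mul, mul_add, hy, hy']
  | path s c d q =>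
  induction z using pathAlgebra_induction with
  | zero => simp
  | add z z' hz hz' => simp only [mul_add, hz, hz']
  | path t e f l =>
  simp only [pathAlgebra_smul_mul, pathAlgebra_mul_smul]
  congr 3
  by_cases h : c = b
  · subst h
    by_cases h' : e = d
    · subst h'
      simp only [ofPath_mul_ofPath, Path.comp_assoc]
    · rw [ofPath_mul_ofPath, ofPath_mul_ofPath_of_ne _ _ h', ofPath_mul_ofPath_of_ne _ _ h',
        mul_zero]
  · rw [ofPath_mul_ofPath_of_ne _ _ h, zero_mul]
    by_cases h' : e = d
    · subst h'
      rw [ofPath_mul_ofPath, ofPath_mul_ofPath_of_ne _ _ h]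
    · rw [ofPath_mul_ofPath_of_ne _ _ h', mul_zero]

variable [Fintype V]

noncomputable instance : One (PathAlgebra K V) := ⟨∑ v : V, ofPath K (Path.nil : Path v v)⟩

theorem one_def : (1 : PathAlgebra K V) = ∑ v : V, ofPath K (Path.nil : Path v v) := rfl

theorem pathAlgebra_one_mul (x : PathAlgebra K V) : 1 * x = x := by
  induction x using pathAlgebra_induction with
  | zero => simp
  | add x x' hx hx' => rw [mul_add, hx, hx']
  | path r a b p =>
  rw [pathAlgebra_mul_smul, one_def, Finset.sum_mul, Finset.sum_eq_single a,
    ofPath_mul_ofPath, Path.nil_comp]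
  · exact fun v _ hv => ofPath_mul_ofPath_of_ne _ _ hv.symm
  · simp

theorem pathAlgebra_mul_one (x : PathAlgebra K V) : x * 1 = x := by
  induction x using pathAlgebra_induction with
  | zero => simp
  | add x x' hx hx' => rw [add_mul, hx, hx']
  | path r a b p =>
  rw [pathAlgebra_smul_mul, one_def, Finset.mul_sum, Finset.sum_eq_single b,
    ofPath_mul_ofPath, Path.comp_nil]
  · exact fun v _ hv => ofPath_mul_ofPath_of_ne _ _ hv
  · simp

noncomputable instance : Ring (PathAlgebra K V) where
  __ := (inferInstance : NonUnitalNonAssocRing (PathAlgebra K V))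
  mul_assoc := pathAlgebra_mul_assoc
  one_mul := pathAlgebra_one_mul
  mul_one := pathAlgebra_mul_one

noncomputable instance : Algebra K (PathAlgebra K V) :=
  Algebra.ofModule pathAlgebra_smul_mul fun r x y => pathAlgebra_mul_smul r x y

end PathAlgebra

section TrivialExtension

/-- The `K`-linear dual `D(A) = Hom_K(A, K)` of a `K`-algebra `A`, as an `A`-`A`-bimodule via
`(a f b)(x) = f (b x a)`. Right multiplication by `b` is the action of `MulOpposite.op b`. -/
def DualBimodule (K : Type w) (A : Type u) [Field K] [Ring A] [Algebra K A] : Type (max u w) :=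
  A →ₗ[K] K

variable {K : Type w} {A : Type u} [Field K] [Ring A] [Algebra K A]

noncomputable instance : AddCommGroup (DualBimodule K A) :=
  inferInstanceAs (AddCommGroup (A →ₗ[K] K))

noncomputable instance : Module K (DualBimodule K A) :=
  inferInstanceAs (Module K (A →ₗ[K] K))

instance : FunLike (DualBimodule K A) A K := inferInstanceAs (FunLike (A →ₗ[K] K) A K)

@[ext]
theorem DualBimodule.ext {f g : DualBimodule K A} (h : ∀ x, f x = g x) : f = g :=
  LinearMap.ext h

@[simp]
theorem DualBimodule.add_apply (f g : DualBimodule K A) (x : A) : (f + g) x = f x + g x := rfl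

@[simp]
theorem DualBimodule.zero_apply (x : A) : (0 : DualBimodule K A) x = 0 := rfl

@[simp]
theorem DualBimodule.smul_apply (r : K) (f : DualBimodule K A) (x : A) : (r • f) x = r • f x := rfl

theorem DualBimodule.map_add (f : DualBimodule K A) (x y : A) : f (x + y) = f x + f y :=
  LinearMap.map_add (show A →ₗ[K] K from f) x y

theorem DualBimodule.map_zero (f : DualBimodule K A) : f 0 = 0 :=
  LinearMap.map_zero (show A →ₗ[K] K from f)

theorem DualBimodule.map_smul (f : DualBimodule K A) (r : K) (x : A) : f (r • x) = r • f x :=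
  LinearMap.map_smul (show A →ₗ[K] K from f) r x

/-- `(a f)(x) = f (x a)` -/
noncomputable instance : SMul A (DualBimodule K A) :=
  ⟨fun a f => (show A →ₗ[K] K from f).comp (LinearMap.mulRight K a)⟩

/-- `(f b)(x) = f (b x)` -/
noncomputable instance : SMul Aᵐᵒᵖ (DualBimodule K A) :=
  ⟨fun b f => (show A →ₗ[K] K from f).comp (LinearMap.mulLeft K b.unop)⟩

theorem DualBimodule.left_smul_apply (a : A) (f : DualBimodule K A) (x : A) :
    (a • f) x = f (x * a) := rfl

theorem DualBimodule.right_smul_apply (b : Aᵐᵒᵖ) (f : DualBimodule K A) (x : A) :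
    (b • f) x = f (b.unop * x) := rfl

noncomputable instance : Module A (DualBimodule K A) where
  one_smul f := by ext x; simp [DualBimodule.left_smul_apply]
  mul_smul a b f := by ext x; simp [DualBimodule.left_smul_apply, mul_assoc]
  smul_zero a := by ext x; simp [DualBimodule.left_smul_apply]
  smul_add a f g := by ext x; simp [DualBimodule.left_smul_apply]
  add_smul a b f := by ext x; simp [DualBimodule.left_smul_apply, mul_add, DualBimodule.map_add]
  zero_smul f := by ext x; simp [DualBimodule.left_smul_apply, DualBimodule.map_zero]

noncomputable instance : Module Aᵐᵒᵖ (DualBimodule K A) where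
  one_smul f := by ext x; simp [DualBimodule.right_smul_apply]
  mul_smul a b f := by ext x; simp [DualBimodule.right_smul_apply, mul_assoc]
  smul_zero a := by ext x; simp [DualBimodule.right_smul_apply]
  smul_add a f g := by ext x; simp [DualBimodule.right_smul_apply]
  add_smul a b f := by ext x; simp [DualBimodule.right_smul_apply, add_mul, DualBimodule.map_add]
  zero_smul f := by ext x; simp [DualBimodule.right_smul_apply, DualBimodule.map_zero]

instance : SMulCommClass A Aᵐᵒᵖ (DualBimodule K A) where
  smul_comm a b f := by
    ext x
    simp [DualBimodule.left_smul_apply, DualBimodule.right_smul_apply, mul_assoc]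

instance : IsScalarTower K A (DualBimodule K A) where
  smul_assoc r a f := by
    ext x
    simp [DualBimodule.left_smul_apply, DualBimodule.map_smul]

instance : IsScalarTower K Aᵐᵒᵖ (DualBimodule K A) where
  smul_assoc r a f := by
    ext x
    simp [DualBimodule.right_smul_apply, DualBimodule.map_smul]

variable (K A) in
/-- The trivial extension `T(A) = A ⋉ D(A)`, with product `(a, f)(b, g) = (ab, ag + fb)`. -/
abbrev TrivialExtension : Type (max u w) := TrivSqZeroExt A (DualBimodule K A)

end TrivialExtension

section Relations

variable {K : Type w} [Field K] {V : Type u} [Quiver.{v} V] [Fintype V]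

variable (K V) in
/-- The `n`-th power of the arrow ideal of `KQ`: the ideal generated by the paths of length `n`. -/
noncomputable def arrowIdealPow (n : ℕ) : TwoSidedIdeal (PathAlgebra K V) :=
  TwoSidedIdeal.span {x | ∃ (a b : V) (p : Path a b), p.length = n ∧ x = ofPath K p}

/-- An ideal `I` of `KQ` is admissible if `J ^ N ⊆ I ⊆ J ^ 2` for some `N ≥ 2`, where `J` is the
arrow ideal. -/
def IsAdmissible (I : TwoSidedIdeal (PathAlgebra K V)) : Prop :=
  ∃ N : ℕ, 2 ≤ N ∧ arrowIdealPow K V N ≤ I ∧ I ≤ arrowIdealPow K V 2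

/-- The algebra `KQ/I`. -/
abbrev BoundAlgebra (I : TwoSidedIdeal (PathAlgebra K V)) : Type (max u v w) :=
  I.ringCon.Quotient

/-- The canonical surjection `KQ → KQ/I`. -/
noncomputable abbrev toBound (I : TwoSidedIdeal (PathAlgebra K V)) :
    PathAlgebra K V →ₐ[K] BoundAlgebra I :=
  RingCon.mkₐ K I.ringCon

/-- The algebra `A = KQ/I` is almost gentle (as presented by `Q` and `I`): it is finite
dimensional, `I` is admissible, and
(S0) `I` is generated by paths of length two;
(S1) for every arrow `a` there is at most one arrow `b` with `ab ∉ I` and at most one arrow `c`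
with `ca ∉ I` (arrows `b`, `c` for which the concatenation is not defined need not be mentioned,
since the product in `KQ` is then `0`). -/
structure IsAlmostGentle (I : TwoSidedIdeal (PathAlgebra K V)) : Prop where
  finiteDimensional : FiniteDimensional K (BoundAlgebra I)
  admissible : IsAdmissible I
  generated : ∃ R : Set (Σ a : V, Σ b : V, Path a b), (∀ p ∈ R, p.2.2.length = 2) ∧
    I = TwoSidedIdeal.span {x | ∃ p ∈ R, x = ofPath K p.2.2}
  unique_right : ∀ {x y z z' : V} (a : x ⟶ y) (b : y ⟶ z) (b' : y ⟶ z'),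
    ofPath K (a.toPath.comp b.toPath) ∉ I → ofPath K (a.toPath.comp b'.toPath) ∉ I →
      Total.mk y z b = Total.mk y z' b'
  unique_left : ∀ {w w' x y : V} (a : x ⟶ y) (c : w ⟶ x) (c' : w' ⟶ x),
    ofPath K (c.toPath.comp a.toPath) ∉ I → ofPath K (c'.toPath.comp a.toPath) ∉ I →
      Total.mk w x c = Total.mk w' x c'

/-- A path `p` is a maximal path of `KQ/I` if `p ∉ I` and `ap ∈ I` and `pa ∈ I` for every
arrow `a`. -/
def IsMaximalPath (I : TwoSidedIdeal (PathAlgebra K V)) {x y : V} (p : Path x y) : Prop :=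
  ofPath K p ∉ I ∧
    (∀ (w : V) (a : w ⟶ x), ofPath K (a.toPath.comp p) ∈ I) ∧
    (∀ (z : V) (a : y ⟶ z), ofPath K (p.comp a.toPath) ∈ I)

end Relations

section Cycles

variable {V : Type u} [Quiver.{v} V]

/-- The list of arrows of a path (in reverse order of traversal). -/
def arrows {a : V} : ∀ {b : V}, Path a b → List (Total V)
  | _, .nil => []
  | _, .cons p e => Total.mk _ _ e :: arrows p

/-- Closed paths of a quiver, with their base point. -/
abbrev ClosedPath (V : Type u) [Quiver.{v} V] : Type (max u v) := Σ x : V, Path x x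

/-- A simple cycle: a closed path of positive length without repeated arrows. -/
def IsSimpleCycle (C : ClosedPath V) : Prop := 0 < C.2.length ∧ (arrows C.2).Nodup

/-- `C'` is a cyclic permutation of `C`: `C = pq` and `C' = qp` for paths `p`, `q`. -/
def IsCyclicPerm (C C' : ClosedPath V) : Prop :=
  ∃ (a b : V) (p : Path a b) (q : Path b a), C = ⟨a, p.comp q⟩ ∧ C' = ⟨b, q.comp p⟩

/-- Powers of a closed path. -/
def closedPow {x : V} (C : Path x x) : ℕ → Path x x
  | 0 => .nil
  | n + 1 => (closedPow C n).comp C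

/-- `p` is a subpath of `q`. -/
def IsSubpath {a b c d : V} (p : Path a b) (q : Path c d) : Prop :=
  ∃ (r : Path c a) (s : Path b d), q = r.comp (p.comp s)

/-- `(S, μ)` is a defining pair in the quiver `V`: `S` is a set of simple cycles, `μ` is a positive
function on `S`, and the conditions D0 to D4 hold. -/
structure IsDefiningPair (S : Set (ClosedPath V)) (μ : ClosedPath V → ℕ) : Prop where
  simple : ∀ C ∈ S, IsSimpleCycle C
  pos : ∀ C ∈ S, 0 < μ C
  d0 : ∀ C ∈ S, C.2.length = 1 → 1 < μ C
  d1 : ∀ C ∈ S, ∀ C', IsCyclicPerm C C' → C' ∈ S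
  d2 : ∀ C ∈ S, ∀ C', IsCyclicPerm C C' → μ C = μ C'
  d3 : ∀ e : Total V, ∃ C ∈ S, e ∈ arrows C.2
  d4 : ∀ C ∈ S, ∀ C' ∈ S, ∀ e : Total V, e ∈ arrows C.2 → e ∈ arrows C'.2 → IsCyclicPerm C C'

/-- The relations attached to `(S, μ)`:
type 1: `C ^ μ(C) - C' ^ μ(C')` for `C`, `C'` in `S` at the same vertex;
type 2: `C ^ μ(C) a` for `C` in `S` with first arrow `a`;
type 3: `ab` for composable arrows `a`, `b` such that `ab` does not lie on any special cycle
(taken with its multiplicity, which only matters when the cycle is a loop). -/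
inductive IsCycleRelation (K : Type w) [Field K] (S : Set (ClosedPath V)) (μ : ClosedPath V → ℕ) :
    PathAlgebra K V → Prop
  | type1 {x : V} (C C' : Path x x) (hC : (⟨x, C⟩ : ClosedPath V) ∈ S)
      (hC' : (⟨x, C'⟩ : ClosedPath V) ∈ S) :
      IsCycleRelation K S μ
        (ofPath K (closedPow C (μ ⟨x, C⟩)) - ofPath K (closedPow C' (μ ⟨x, C'⟩)))
  | type2 {x y : V} (C : Path x x) (hC : (⟨x, C⟩ : ClosedPath V) ∈ S) (a : x ⟶ y) (q : Path y x)
      (ha : C = a.toPath.comp q) :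
      IsCycleRelation K S μ (ofPath K ((closedPow C (μ ⟨x, C⟩)).comp a.toPath))
  | type3 {x y z : V} (a : x ⟶ y) (b : y ⟶ z)
      (hab : ∀ C ∈ S, ¬ IsSubpath (a.toPath.comp b.toPath) (closedPow C.2 (μ C))) :
      IsCycleRelation K S μ (ofPath K (a.toPath.comp b.toPath))

/-- The ideal of relations of the algebra defined by cycles `(S, μ)`. -/
noncomputable def cycleIdeal (K : Type w) [Field K] [Fintype V] (S : Set (ClosedPath V))
    (μ : ClosedPath V → ℕ) : TwoSidedIdeal (PathAlgebra K V) :=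
  TwoSidedIdeal.span {x | IsCycleRelation K S μ x}

/-- `D` is an admissible cut with respect to the set `S` of special cycles: `D` contains exactly
one of the arrows of each special cycle (a condition invariant under cyclic permutation, so it does
not matter whether it is required for all special cycles or for representatives of their classes
under cyclic permutation). -/
def IsAdmissibleCut (S : Set (ClosedPath V)) (D : Set (Total V)) : Prop :=
  ∀ C ∈ S, ∃! e : Total V, e ∈ D ∧ e ∈ arrows C.2

/-- The ideal generated by `I ∪ D`, where `D` is a set of arrows. -/
noncomputable def cutIdeal {K : Type w} [Field K] [Fintype V] (I : TwoSidedIdeal (PathAlgebra K V))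
    (D : Set (Total V)) : TwoSidedIdeal (PathAlgebra K V) :=
  TwoSidedIdeal.span ({x | x ∈ I} ∪ {x | ∃ e ∈ D, x = ofPath K e.hom.toPath})

/-- The cut algebra `KQ/⟨I ∪ D⟩` associated to a set `D` of arrows. -/
abbrev CutAlgebra {K : Type w} [Field K] [Fintype V] (I : TwoSidedIdeal (PathAlgebra K V))
    (D : Set (Total V)) : Type (max u v w) :=
  BoundAlgebra (cutIdeal I D)

end Cycles

section ExtendedQuiver

variable {K : Type w} [Field K] {V : Type u} [Quiver.{v} V] [Fintype V]
  (I : TwoSidedIdeal (PathAlgebra K V))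

/-- The vertices of the quiver of `T(A)`, for `A = KQ/I`: the same as those of `Q`. -/
def ExtQuiver (_I : TwoSidedIdeal (PathAlgebra K V)) : Type u := V

instance : Fintype (ExtQuiver I) := inferInstanceAs (Fintype V)

/-- The arrows of the quiver of `T(A)`: those of `Q`, together with one new arrow from the end to
the start of `m` for each maximal path `m` of `A`. -/
instance : Quiver.{max u v} (ExtQuiver I) where
  Hom x y := Quiver.Hom (V := V) x y ⊕ {m : Path (V := V) y x // IsMaximalPath I m}

/-- The inclusion of `Q` into the quiver of `T(A)`. -/
def incl : V ⥤q ExtQuiver I where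
  obj x := x
  map e := Sum.inl e

/-- The new arrow `β_m` attached to the maximal path `m`. -/
def newArrow {x y : V} (m : Path x y) (hm : IsMaximalPath I m) :
    (incl I).obj y ⟶ (incl I).obj x :=
  Sum.inr ⟨m, hm⟩

/-- The set `{β_m}` of all new arrows. -/
def newArrows : Set (Total (ExtQuiver I)) :=
  {e | ∃ (x y : V) (m : Path x y) (hm : IsMaximalPath I m),
    e = Total.mk ((incl I).obj y) ((incl I).obj x) (newArrow I m hm)}

/-- The cycle `C_m = m β_m`. -/
def maximalCycle {x y : V} (m : Path x y) (hm : IsMaximalPath I m) : ClosedPath (ExtQuiver I) :=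
  ⟨(incl I).obj x, ((incl I).mapPath m).comp (newArrow I m hm).toPath⟩

/-- The special cycles: all cyclic permutations of the cycles `C_m = m β_m`. -/
def specialCycles : Set (ClosedPath (ExtQuiver I)) :=
  {C | ∃ (x y : V) (m : Path x y) (hm : IsMaximalPath I m), IsCyclicPerm (maximalCycle I m hm) C}

open Classical in
/-- The algebra homomorphism `φ : KQ_{T(A)} → T(A)` is the canonical one: it sends a trivial path
`e_x` to `(e_x, 0)`, an arrow `a` of `Q` to `(a, 0)`, and the new arrow `β_m` to `(0, m^∨)`, where
`m^∨` is the linear form on `A` with `m^∨(m) = 1` and `m^∨(p) = 0` for all other paths `p ∉ I`. -/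
structure IsCanonical
    (φ : PathAlgebra K (ExtQuiver I) →ₐ[K] TrivialExtension K (BoundAlgebra I)) : Prop where
  vertex : ∀ x : V, φ (ofPath K (Path.nil : Path ((incl I).obj x) ((incl I).obj x))) =
    TrivSqZeroExt.inl (toBound I (ofPath K (Path.nil : Path x x)))
  arrow : ∀ {x y : V} (a : x ⟶ y), φ (ofPath K ((incl I).map a).toPath) =
    TrivSqZeroExt.inl (toBound I (ofPath K a.toPath))
  newArrow : ∀ {x y : V} (m : Path x y) (hm : IsMaximalPath I m),
    ∃ f : DualBimodule K (BoundAlgebra I),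
      φ (ofPath K (newArrow I m hm).toPath) = TrivSqZeroExt.inr f ∧
      ∀ {c d : V} (p : Path c d), ofPath K p ∉ I →
        f (toBound I (ofPath K p)) =
          if (⟨c, d, p⟩ : Σ a : V, Σ b : V, Path a b) = ⟨x, y, m⟩ then 1 else 0

end ExtendedQuiver

end AlmostGentle

open AlmostGentle

/-! Since `I` is generated by paths of length two, a path lies outside `I` exactly when each pair of
consecutive arrows does (`notMem_iff`), and such paths form a basis of `A`. The almost gentle
condition makes the continuation of a nonzero path unique in both directions, and admissibility
bounds its length. Hence no arrow repeats, and every nonzero path of positive length lies in exactly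
one maximal path, at exactly one place (`exists_maximal`, `eq_of_maximal`).

Let `φ` send `β_m` to `m^∨`. A path `q β_m p` goes to `z^∨` if `m = p z q`, and to `0` if there is
no such `z`. Every nonzero `z` occurs in this way, so all of `D(A)` is reached and `φ` is
surjective. The cycle relations lie in the kernel (`relIdeal_le_ker`): special cycles at `v` all go
to `e_v^∨`, which every arrow kills.

Conversely, modulo the cycle relations, a path with two new arrows vanishes (`new_old_new_mem`). A
path `q β_m p` either vanishes or is complementary to some `z` in a special cycle (`around_mem_or`),
and any two complements of `z` agree (`around_sub_complement_mem`). So every element is congruent to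
an element of `KQ` plus a combination of chosen complements, both read off from its image
(`sub_mem_relIdeal`); this gives `ker_canonical`.

Each special cycle contains one new arrow, so the new arrows form a cut. Killing them kills `D(A)`,
since every complement passes through a new arrow; what remains is `A`. -/

namespace AlmostGentle

open Quiver

set_option linter.unusedSectionVars false

universe u v w

/-! ### Chains for a deterministic relation. -/

section Lists

variable {α : Type u} {R : α → α → Prop}

/-- Each entry forces the next one, so two chains with the same head can differ only in length. -/
theorem chain_prefix_or_prefix (hR : ∀ a b c, R a b → R a c → b = c) :
    ∀ (a : α) (l l' : List α), (a :: l).IsChain R → (a :: l').IsChain R → l <+: l' ∨ l' <+: l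
  | _, [], _, _, _ => Or.inl List.nil_prefix
  | _, _ :: _, [], _, _ => Or.inr List.nil_prefix
  | a, b :: l, c :: l', h, h' => by
    rw [List.isChain_cons_cons] at h h'
    obtain rfl := hR a b c h.1 h'.1
    rcases chain_prefix_or_prefix hR b l l' h.2 h'.2 with h | h
    · exact Or.inl (by simpa using h)
    · exact Or.inr (by simpa using h)

theorem chain_suffix_or_suffix (hR : ∀ a b c, R b a → R c a → b = c) (a : α) (l l' : List α)
    (h : (l ++ [a]).IsChain R) (h' : (l' ++ [a]).IsChain R) : l <:+ l' ∨ l' <:+ l := by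
  have := chain_prefix_or_prefix (R := fun x y => R y x) hR a l.reverse l'.reverse
    (by simpa using List.isChain_reverse.2 h)
    (by simpa using List.isChain_reverse.2 h')
  simpa using this

/-- Being a chain concerns adjacent pairs only, and a nonempty overlap `m` ensures that no pair
straddles `l` and `r`. -/
theorem isChain_glue {l m r : List α} (hm : m ≠ []) (h : (l ++ m).IsChain R)
    (h' : (m ++ r).IsChain R) : (l ++ m ++ r).IsChain R := by
  obtain ⟨m, a, rfl⟩ := List.eq_nil_or_concat m |>.resolve_left hm
  rw [List.isChain_append] at h' ⊢
  refine ⟨h, h'.2.1, ?_⟩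
  intro x hx y hy
  refine h'.2.2 x ?_ y hy
  simpa using hx

/-- An adjacent pair in `p ++ b :: q` is inside `p`, inside `q`, or contains `b`. -/
theorem pair_in_append_cons {s t p q : List α} {e f b : α}
    (h : s ++ f :: e :: t = p ++ b :: q) :
    (f = b ∧ q = e :: t) ∨ (e = b ∧ p = s ++ [f]) ∨
      (∃ p', p = s ++ f :: e :: p') ∨ ∃ s', q = s' ++ f :: e :: t := by
  rw [List.append_eq_append_iff] at h
  rcases h with ⟨l, rfl, h⟩ | ⟨l, rfl, h⟩
  · match l, h with
    | [], h => simp at h; exact Or.inl ⟨h.1, h.2.symm⟩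
    | [x], h => simp at h; exact Or.inr (Or.inl ⟨h.2.1, by simp [h.1]⟩)
    | x :: y :: l, h => simp at h; exact Or.inr (Or.inr (Or.inl ⟨l, by simp [h.1, h.2.1]⟩))
  · match l, h with
    | [], h => simp at h; exact Or.inl ⟨h.1.symm, h.2⟩
    | x :: l, h => simp at h; exact Or.inr (Or.inr (Or.inr ⟨l, h.2⟩))

end Lists

/-! ### Paths as reversed lists of arrows, and cyclic permutation as list rotation. -/

section PathLists

variable {V : Type u} [Quiver.{v} V]

@[simp] theorem arrows_nil {a : V} : arrows (Path.nil : Path a a) = [] := rfl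

@[simp] theorem arrows_cons {a b c : V} (p : Path a b) (e : b ⟶ c) :
    arrows (p.cons e) = Total.mk _ _ e :: arrows p := rfl

@[simp] theorem arrows_toPath {a b : V} (e : a ⟶ b) : arrows e.toPath = [Total.mk _ _ e] := rfl

@[simp] theorem arrows_comp {a b c : V} (p : Path a b) (q : Path b c) :
    arrows (p.comp q) = arrows q ++ arrows p := by
  induction q with
  | nil => simp
  | cons q e ih => simp [ih]

@[simp] theorem length_arrows {a b : V} (p : Quiver.Path a b) : (arrows p).length = p.length := by
  induction p with
  | nil => simp
  | cons q e ih => simp [ih]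

theorem arrows_eq_nil {a b : V} {p : Path a b} : arrows p = [] ↔ p.length = 0 := by
  rw [← length_arrows, List.length_eq_zero_iff]

theorem arrows_injective {a b : V} {p q : Path a b} (h : arrows p = arrows q) : p = q := by
  induction p with
  | nil =>
    exact (Path.eq_nil_of_length_zero q (arrows_eq_nil.1 (by simpa using h.symm))).symm
  | cons p e ih =>
    cases q with
    | nil => simp at h
    | cons q f =>
      simp only [arrows_cons, List.cons.injEq] at h
      cases h.1
      rw [ih h.2]

theorem end_eq_of_arrows_eq {a b c : V} (p : Path a b) (q : Path a c) (h : arrows p = arrows q) :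
    b = c := by
  cases p with
  | nil => exact Path.eq_of_length_zero q (arrows_eq_nil.1 (by simpa using h.symm))
  | cons p e =>
    cases q with
    | nil => simp at h
    | cons q f => exact congrArg Total.right (List.cons.inj h).1

/-- All trivial paths have the empty list, hence the nonemptiness hypothesis; otherwise the extreme
arrows fix the ends. -/
theorem ends_eq_of_arrows_eq {a b c d : V} (p : Path a b) (q : Path c d)
    (h : arrows p = arrows q) (hp : arrows p ≠ []) : a = c ∧ b = d := by
  have hac : a = c := by
    induction p generalizing d with
    | nil => simp at hp
    | cons p e ih =>
      cases q with
      | nil => simp at h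
      | cons q f =>
        simp only [arrows_cons, List.cons.injEq] at h
        by_cases hp' : arrows p = []
        · have h1 := Path.eq_of_length_zero p (arrows_eq_nil.1 hp')
          have h2 := Path.eq_of_length_zero q (arrows_eq_nil.1 (h.2 ▸ hp'))
          have h3 := congrArg Total.left h.1
          simp only at h3
          rw [h1, h2, h3]
        · exact ih q h.2 hp'
  subst hac
  exact ⟨rfl, end_eq_of_arrows_eq p q h⟩

theorem closedPath_eq_of_arrows_eq {C C' : ClosedPath V} (h : arrows C.2 = arrows C'.2)
    (hp : arrows C.2 ≠ []) : C = C' := by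
  obtain ⟨a, p⟩ := C
  obtain ⟨b, q⟩ := C'
  obtain ⟨rfl, -⟩ := ends_eq_of_arrows_eq p q h hp
  exact congrArg (Sigma.mk a) (arrows_injective h)

/-- A splitting of the list of arrows of a path comes from a splitting of the path. -/
theorem exists_split {a b : V} (p : Path a b) (l l' : List (Total V)) (h : arrows p = l ++ l') :
    ∃ (c : V) (q : Path a c) (r : Path c b), p = q.comp r ∧ arrows q = l' ∧ arrows r = l := by
  induction p generalizing l with
  | nil =>
    simp at h
    exact ⟨a, Path.nil, Path.nil, rfl, by simp [h.2], by simp [h.1]⟩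
  | @cons b c p e ih =>
    cases l with
    | nil => exact ⟨c, p.cons e, Path.nil, rfl, by simpa using h, rfl⟩
    | cons x l =>
      simp only [arrows_cons, List.cons_append, List.cons.injEq] at h
      obtain ⟨d, q, r, rfl, hq, hr⟩ := ih l h.2
      exact ⟨d, q, r.cons e, rfl, hq, by simp [h.1, hr]⟩

/-- Lists run backwards along the path, so a prefix of the list is a final segment of the path, and
a suffix is an initial one. -/
theorem exists_eq_comp_of_prefix {x y a : V} {m : Path x y} {q : Path a y}
    (h : arrows q <+: arrows m) : ∃ r : Quiver.Path x a, m = r.comp q := by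
  obtain ⟨l, hl⟩ := h
  obtain ⟨c, r, q', rfl, -, hq⟩ := exists_split m _ _ hl.symm
  by_cases h0 : arrows q = []
  · have h1 := Path.eq_of_length_zero q (arrows_eq_nil.1 h0)
    subst h1
    refine ⟨r.comp q', arrows_injective ?_⟩
    simp [h0]
  · obtain ⟨rfl, -⟩ := ends_eq_of_arrows_eq q q' hq.symm h0
    obtain rfl := arrows_injective hq
    exact ⟨r, rfl⟩

theorem exists_eq_comp_of_suffix {x y a : V} {m : Path x y} {p : Path x a}
    (h : arrows p <:+ arrows m) : ∃ r : Quiver.Path a y, m = p.comp r := by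
  obtain ⟨l, hl⟩ := h
  obtain ⟨c, p', r, rfl, hp, -⟩ := exists_split m _ _ hl.symm
  obtain rfl := end_eq_of_arrows_eq p p' hp.symm
  obtain rfl := arrows_injective hp
  exact ⟨r, rfl⟩

theorem exists_eq_toPath_comp {a b : V} (p : Path a b) (hp : arrows p ≠ []) :
    ∃ (c : V) (e : a ⟶ c) (q : Path c b), p = e.toPath.comp q := by
  obtain ⟨c, e, q, h, -⟩ :=
    (Path.length_ne_zero_iff_eq_comp p).1 fun h => hp (arrows_eq_nil.2 h)
  exact ⟨c, e, q, h⟩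

theorem IsCyclicPerm.isRotated {C C' : ClosedPath V} (h : IsCyclicPerm C C') :
    arrows C.2 ~r arrows C'.2 := by
  obtain ⟨a, b, p, q, rfl, rfl⟩ := h
  simpa using List.isRotated_append

theorem isCyclicPerm_of_isRotated {C C' : ClosedPath V} (h : arrows C.2 ~r arrows C'.2)
    (hC : arrows C.2 ≠ []) : IsCyclicPerm C C' := by
  obtain ⟨n, hn⟩ := h
  obtain ⟨k, hk, hn⟩ : ∃ k ≤ (arrows C.2).length, (arrows C.2).rotate k = arrows C'.2 :=
    List.isRotated_iff_mod.1 ⟨n, hn⟩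
  rw [List.rotate_eq_drop_append_take hk] at hn
  obtain ⟨c, q, r, hC', hq, hr⟩ := exists_split C.2 _ _ (List.take_append_drop k _).symm
  refine ⟨C.1, c, q, r, by rw [← hC'], ?_⟩
  refine closedPath_eq_of_arrows_eq ?_ ?_
  · simp [hq, hr, hn]
  · rw [← hn]
    intro h
    apply hC
    simp only [List.append_eq_nil_iff] at h
    rw [← List.take_append_drop k (arrows C.2), h.1, h.2]
    rfl

end PathLists

/-! ### Linear maps out of the path algebra. -/

section Linear

variable {K : Type w} [Field K] {V : Type u} [Quiver.{v} V]

/-- The linear map on the path algebra with prescribed values on paths. -/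
noncomputable def pathLin {M : Type*} [AddCommGroup M] [Module K M]
    (g : (Σ a : V, Σ b : V, Quiver.Path a b) → M) : PathAlgebra K V →ₗ[K] M :=
  Finsupp.linearCombination K g

@[simp] theorem pathLin_ofPath {M : Type*} [AddCommGroup M] [Module K M]
    (g : (Σ a : V, Σ b : V, Quiver.Path a b) → M) {a b : V} (p : Quiver.Path a b) :
    pathLin g (ofPath K p) = g ⟨a, b, p⟩ := by
  rw [pathLin, ofPath]
  erw [Finsupp.linearCombination_single, one_smul]

theorem pathAlgebra_linearMap_ext {M : Type*} [AddCommGroup M] [Module K M]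
    {f g : PathAlgebra K V →ₗ[K] M}
    (h : ∀ (a b : V) (p : Quiver.Path a b), f (ofPath K p) = g (ofPath K p)) : f = g := by
  ext x
  induction x using pathAlgebra_induction with
  | zero => simp
  | add x y hx hy => rw [_root_.map_add, _root_.map_add, hx, hy]
  | path r a b p => rw [_root_.map_smul, _root_.map_smul, h]

open Classical in
variable (K) in
/-- The coefficient of a path. -/
noncomputable def coeff (p : Σ a : V, Σ b : V, Quiver.Path a b) : PathAlgebra K V →ₗ[K] K :=
  pathLin fun q => if q = p then 1 else 0

open Classical in
@[simp] theorem coeff_ofPath (p : Σ a : V, Σ b : V, Quiver.Path a b) {a b : V}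
    (q : Quiver.Path a b) : coeff K p (ofPath K q) = if ⟨a, b, q⟩ = p then 1 else 0 := by
  simp [coeff]

end Linear

/-! ### Algebra maps out of the path algebra. -/

section Lift

variable {K : Type w} [Field K] {V : Type u} [Quiver.{v} V] [Fintype V]

variable (V) in
/-- Images of the trivial paths and of the arrows that define an algebra map out of the path
algebra. -/
structure PathRep (B : Type*) [Ring B] where
  vert : V → B
  arr : ∀ {x y : V}, (x ⟶ y) → B
  vert_mul_vert : ∀ x, vert x * vert x = vert x
  vert_mul_vert_of_ne : ∀ x y, x ≠ y → vert x * vert y = 0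
  sum_vert : ∑ x, vert x = 1
  vert_mul_arr : ∀ {x y : V} (a : x ⟶ y), vert x * arr a = arr a
  arr_mul_vert : ∀ {x y : V} (a : x ⟶ y), arr a * vert y = arr a

namespace PathRep

variable {B : Type*} [Ring B] (ρ : PathRep V B)

/-- The image of a path. -/
def onPath {a : V} : ∀ {b : V}, Quiver.Path a b → B
  | _, .nil => ρ.vert a
  | _, .cons p e => onPath p * ρ.arr e

theorem onPath_mul_vert {a b : V} (p : Quiver.Path a b) : ρ.onPath p * ρ.vert b = ρ.onPath p := by
  cases p with
  | nil => exact ρ.vert_mul_vert _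
  | cons p e => rw [onPath, mul_assoc, ρ.arr_mul_vert]

theorem vert_mul_onPath {a b : V} (p : Quiver.Path a b) : ρ.vert a * ρ.onPath p = ρ.onPath p := by
  induction p with
  | nil => exact ρ.vert_mul_vert _
  | cons p e ih => rw [onPath, ← mul_assoc, ih]

theorem onPath_comp {a b c : V} (p : Quiver.Path a b) (q : Quiver.Path b c) :
    ρ.onPath (p.comp q) = ρ.onPath p * ρ.onPath q := by
  induction q with
  | nil => exact (ρ.onPath_mul_vert p).symm
  | cons q e ih => rw [Path.comp_cons, onPath, ih, onPath, mul_assoc]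

theorem onPath_toPath {a b : V} (e : a ⟶ b) : ρ.onPath e.toPath = ρ.arr e := ρ.vert_mul_arr e

variable [Algebra K B]

variable (K) in
/-- The algebra map determined by the images of trivial paths and arrows. -/
noncomputable def lift : PathAlgebra K V →ₐ[K] B :=
  AlgHom.ofLinearMap (pathLin fun p => ρ.onPath p.2.2)
    (by rw [one_def, map_sum, ← ρ.sum_vert]; simp [onPath])
    (by
      intro x y
      induction x using pathAlgebra_induction with
      | zero => simp
      | add x x' hx hx' => simp only [add_mul, _root_.map_add, hx, hx']
      | path r a b p =>
      induction y using pathAlgebra_induction with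
      | zero => simp
      | add y y' hy hy' => simp only [mul_add, _root_.map_add, hy, hy']
      | path s c d q =>
      simp only [_root_.map_smul, smul_mul_assoc, mul_smul_comm]
      congr 2
      by_cases h : c = b
      · subst h
        simp only [ofPath_mul_ofPath, pathLin_ofPath, onPath_comp]
      -- The idempotents at `b` and `c` can be inserted between the two images, and they are
      -- orthogonal.
      · rw [ofPath_mul_ofPath_of_ne _ _ h, map_zero, pathLin_ofPath, pathLin_ofPath,
          ← ρ.onPath_mul_vert p, ← ρ.vert_mul_onPath q, mul_assoc, ← mul_assoc (ρ.vert b),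
          ρ.vert_mul_vert_of_ne _ _ (Ne.symm h)]
        simp)

@[simp] theorem lift_ofPath {a b : V} (p : Quiver.Path a b) :
    ρ.lift K (ofPath K p) = ρ.onPath p := by
  simp [lift]

end PathRep

end Lift

/-! ### The quotient `KQ/I` and membership of paths in ideals. -/

section Bound

variable {K : Type w} [Field K] {V : Type u} [Quiver.{v} V] [Fintype V]
  {I : TwoSidedIdeal (PathAlgebra K V)}

theorem toBound_surjective (I : TwoSidedIdeal (PathAlgebra K V)) :
    Function.Surjective (toBound I) :=
  RingCon.mkₐ_surjective I.ringCon

theorem toBound_eq_zero {x : PathAlgebra K V} : toBound I x = 0 ↔ x ∈ I := by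
  rw [← map_zero (toBound I), TwoSidedIdeal.mem_iff]
  exact I.ringCon.eq

theorem toBound_eq {x y : PathAlgebra K V} : toBound I x = toBound I y ↔ x - y ∈ I := by
  rw [← toBound_eq_zero, map_sub, sub_eq_zero]

/-- The linear map on `KQ/I` induced by a linear map that vanishes on `I`. -/
noncomputable def liftBound {M : Type*} [AddCommGroup M] [Module K M]
    (f : PathAlgebra K V →ₗ[K] M) (hf : ∀ x ∈ I, f x = 0) : BoundAlgebra I →ₗ[K] M :=
  have key : ∀ x, f (Function.surjInv (toBound_surjective I) (toBound I x)) = f x := fun x => by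
    rw [← sub_eq_zero, ← map_sub]
    exact hf _ (toBound_eq.1 (Function.surjInv_eq (toBound_surjective I) _))
  { toFun := fun x => f (Function.surjInv (toBound_surjective I) x)
    map_add' := fun x y => by
      obtain ⟨x, rfl⟩ := toBound_surjective I x
      obtain ⟨y, rfl⟩ := toBound_surjective I y
      rw [← _root_.map_add, key, key, key, _root_.map_add]
    map_smul' := fun r x => by
      obtain ⟨x, rfl⟩ := toBound_surjective I x
      rw [← _root_.map_smul, key, key, _root_.map_smul, RingHom.id_apply] }

@[simp] theorem liftBound_toBound {M : Type*} [AddCommGroup M] [Module K M]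
    (f : PathAlgebra K V →ₗ[K] M) (hf : ∀ x ∈ I, f x = 0) (x : PathAlgebra K V) :
    liftBound f hf (toBound I x) = f x := by
  change f (Function.surjInv (toBound_surjective I) (toBound I x)) = f x
  rw [← sub_eq_zero, ← map_sub]
  exact hf _ (toBound_eq.1 (Function.surjInv_eq (toBound_surjective I) _))

theorem boundAlgebra_linearMap_ext {M : Type*} [AddCommGroup M] [Module K M]
    {f g : BoundAlgebra I →ₗ[K] M}
    (h : ∀ (a b : V) (p : Quiver.Path a b),
      f (toBound I (ofPath K p)) = g (toBound I (ofPath K p))) : f = g := by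
  have : f ∘ₗ (toBound I).toLinearMap = g ∘ₗ (toBound I).toLinearMap :=
    pathAlgebra_linearMap_ext h
  ext x
  obtain ⟨x, rfl⟩ := toBound_surjective I x
  exact LinearMap.congr_fun this x

theorem dualBimodule_ext {f g : DualBimodule K (BoundAlgebra I)}
    (h : ∀ (a b : V) (p : Quiver.Path a b),
      f (toBound I (ofPath K p)) = g (toBound I (ofPath K p))) : f = g :=
  boundAlgebra_linearMap_ext (f := f) (g := g) h

theorem comp_mem_left {a b c : V} (p : Quiver.Path a b) {q : Quiver.Path b c}
    (h : ofPath K q ∈ I) : ofPath K (p.comp q) ∈ I := by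
  rw [← ofPath_mul_ofPath]
  exact I.mul_mem_left _ _ h

theorem comp_mem_right {a b c : V} {p : Quiver.Path a b} (q : Quiver.Path b c)
    (h : ofPath K p ∈ I) : ofPath K (p.comp q) ∈ I := by
  rw [← ofPath_mul_ofPath]
  exact I.mul_mem_right _ _ h

theorem smul_mem_twoSidedIdeal (r : K) {x : PathAlgebra K V} (h : x ∈ I) : r • x ∈ I := by
  rw [← one_mul x, ← pathAlgebra_smul_mul]
  exact I.mul_mem_left _ _ h

/-- The generators have length exactly `n`; a longer path factors through its last `n` arrows, the
first `n` entries of its list. -/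
theorem ofPath_mem_arrowIdealPow {a b : V} (p : Quiver.Path a b) {n : ℕ} (h : n ≤ p.length) :
    ofPath K p ∈ arrowIdealPow K V n := by
  obtain ⟨c, q, r, rfl, -, hr⟩ := exists_split p ((arrows p).take n) ((arrows p).drop n)
    (List.take_append_drop n _).symm
  apply comp_mem_left
  refine TwoSidedIdeal.subset_span ⟨_, _, r, ?_, rfl⟩
  rw [← length_arrows, hr, List.length_take, length_arrows]
  exact min_eq_left h

end Bound

/-! ### Nonzero paths of a quadratic monomial algebra. -/

section Monomial

variable {K : Type w} [Field K] {V : Type u} [Quiver.{v} V] [Fintype V]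
  {I : TwoSidedIdeal (PathAlgebra K V)}

variable (I) in
/-- `Allowed I f e`: the arrow `f` can follow the arrow `e` in a path that is not in `I`. -/
def Allowed (f e : Total V) : Prop :=
  ∃ (x y z : V) (a : x ⟶ y) (b : y ⟶ z), e = Total.mk _ _ a ∧ f = Total.mk _ _ b ∧
    ofPath K (a.toPath.comp b.toPath) ∉ I

theorem isChain_of_notMem {a b : V} {p : Quiver.Path a b} (h : ofPath K p ∉ I) :
    (arrows p).IsChain (Allowed I) := by
  induction p with
  | nil => simp
  | cons p e ih =>
    have hp : ofPath K p ∉ I := fun hp => h (comp_mem_right e.toPath hp)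
    cases p with
    | nil => simp
    | cons p e' =>
      rw [arrows_cons, arrows_cons, List.isChain_cons_cons]
      refine ⟨⟨_, _, _, e', e, rfl, rfl, fun h' => h ?_⟩, ih hp⟩
      exact comp_mem_left p h'

variable (I) in
/-- The linear span of the paths that contain a forbidden pair of arrows. -/
noncomputable def forbidden : Submodule K (PathAlgebra K V) :=
  Submodule.span K {x | ∃ (a b : V) (p : Quiver.Path a b),
    ¬ (arrows p).IsChain (Allowed I) ∧ x = ofPath K p}

/-- With `mul_mem_forbidden'`, this makes the span a two-sided ideal, so that it can be compared
with `I` on generators. -/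
theorem mul_mem_forbidden (x y : PathAlgebra K V) (hy : y ∈ forbidden I) :
    x * y ∈ forbidden I := by
  induction x using pathAlgebra_induction with
  | zero => simp
  | add x x' hx hx' => rw [add_mul]; exact add_mem hx hx'
  | path r a b p =>
  rw [pathAlgebra_smul_mul]
  apply Submodule.smul_mem
  induction hy using Submodule.span_induction with
  | zero => simp
  | add y y' _ _ hy hy' => rw [mul_add]; exact add_mem hy hy'
  | smul r y _ hy => rw [pathAlgebra_mul_smul]; exact Submodule.smul_mem _ _ hy
  | mem y hy =>
    obtain ⟨c, d, q, hq, rfl⟩ := hy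
    by_cases h : c = b
    · subst h
      rw [ofPath_mul_ofPath]
      refine Submodule.subset_span ⟨_, _, _, fun h => hq ?_, rfl⟩
      rw [arrows_comp] at h
      exact h.left_of_append
    · rw [ofPath_mul_ofPath_of_ne _ _ h]
      exact zero_mem _

theorem mul_mem_forbidden' (x y : PathAlgebra K V) (hx : x ∈ forbidden I) :
    x * y ∈ forbidden I := by
  induction y using pathAlgebra_induction with
  | zero => simp
  | add x x' hx hx' => rw [mul_add]; exact add_mem hx hx'
  | path r a b p =>
  rw [pathAlgebra_mul_smul]
  apply Submodule.smul_mem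
  induction hx using Submodule.span_induction with
  | zero => simp
  | add y y' _ _ hy hy' => rw [add_mul]; exact add_mem hy hy'
  | smul r y _ hy => rw [pathAlgebra_smul_mul]; exact Submodule.smul_mem _ _ hy
  | mem y hy =>
    obtain ⟨c, d, q, hq, rfl⟩ := hy
    by_cases h : a = d
    · subst h
      rw [ofPath_mul_ofPath]
      refine Submodule.subset_span ⟨_, _, _, fun h => hq ?_, rfl⟩
      rw [arrows_comp] at h
      exact h.right_of_append
    · rw [ofPath_mul_ofPath_of_ne _ _ h]
      exact zero_mem _

variable (hI : IsAlmostGentle I)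
include hI

/-- Each generator of `I` has length two, so it is itself a forbidden pair. -/
theorem mem_forbidden {x : PathAlgebra K V} (hx : x ∈ I) : x ∈ forbidden I := by
  obtain ⟨R, hR, hIR⟩ := hI.generated
  have hle : I ≤ TwoSidedIdeal.mk' (forbidden I : Set (PathAlgebra K V)) (zero_mem _)
      (fun h h' => add_mem h h') (fun h => neg_mem h) (fun h => mul_mem_forbidden _ _ h)
      (fun h => mul_mem_forbidden' _ _ h) := by
    refine hIR.le.trans (TwoSidedIdeal.span_le.2 ?_)
    rintro x ⟨⟨a, b, p⟩, hp, rfl⟩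
    rw [SetLike.mem_coe, TwoSidedIdeal.mem_mk']
    refine Submodule.subset_span ⟨_, _, p, fun hc => ?_, rfl⟩
    have hpI : ofPath K p ∈ I := by
      exact hIR.ge (TwoSidedIdeal.subset_span ⟨_, hp, rfl⟩)
    have hlen := hR _ hp
    match b, p, hlen with
    | _, .cons (.cons .nil e) e', _ =>
      rw [arrows_cons, arrows_cons, List.isChain_cons_cons] at hc
      obtain ⟨x, y, z, a, b, h, h', hab⟩ := hc.1
      cases h
      cases h'
      exact hab hpI
  have := hle hx
  rwa [TwoSidedIdeal.mem_mk'] at this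

/-- This is what lets the coefficient of a nonzero path descend to `KQ/I`, where it becomes the dual
form. -/
theorem coeff_eq_zero {a b : V} {p : Quiver.Path a b} (hp : (arrows p).IsChain (Allowed I))
    {x : PathAlgebra K V} (hx : x ∈ I) : coeff K ⟨a, b, p⟩ x = 0 := by
  have hx' := mem_forbidden hI hx
  clear hx
  induction hx' using Submodule.span_induction with
  | zero => simp
  | add y y' _ _ hy hy' => rw [_root_.map_add, hy, hy', add_zero]
  | smul r y _ hy => rw [_root_.map_smul, hy, smul_zero]
  | mem y hy =>
    obtain ⟨c, d, q, hq, rfl⟩ := hy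
    rw [coeff_ofPath, if_neg]
    intro h
    cases h
    exact hq hp

theorem notMem_iff {a b : V} {p : Quiver.Path a b} :
    ofPath K p ∉ I ↔ (arrows p).IsChain (Allowed I) := by
  refine ⟨isChain_of_notMem, fun h hp => ?_⟩
  simpa using coeff_eq_zero hI h hp

end Monomial

/-! ### Repetitions in lists. -/

section ListExtra

variable {α : Type u}

theorem exists_repeat_of_not_nodup : ∀ {l : List α}, ¬ l.Nodup →
    ∃ (s u v : List α) (e : α), l = s ++ e :: u ++ e :: v
  | [], h => absurd List.nodup_nil h
  | a :: l, h => by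
    by_cases ha : a ∈ l
    · obtain ⟨u, v, rfl⟩ := List.append_of_mem ha
      exact ⟨[], u, v, a, by simp⟩
    · obtain ⟨s, u, v, e, rfl⟩ := exists_repeat_of_not_nodup (l := l) fun hl =>
        h (List.nodup_cons.2 ⟨ha, hl⟩)
      exact ⟨a :: s, u, v, e, by simp⟩

theorem append_cons_inj_of_nodup {s t s' t' : List α} {e : α} (h : s ++ e :: t = s' ++ e :: t')
    (hn : (s ++ e :: t).Nodup) : s = s' ∧ t = t' := by
  have h1 : e ∉ s := fun he => (List.disjoint_of_nodup_append hn) he (by simp)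
  have h2 : e ∉ s' := fun he => (List.disjoint_of_nodup_append (h ▸ hn)) he (by simp)
  rw [List.append_eq_append_iff] at h
  rcases h with ⟨l, rfl, h⟩ | ⟨l, rfl, h⟩
  · cases l with
    | nil => simpa using h
    | cons x l => simp at h; simp [h.1] at h2
  · cases l with
    | nil => simpa using h.symm
    | cons x l => simp at h; simp [h.1] at h1

end ListExtra

/-! ### Maximal paths: existence, uniqueness, absence of repeated arrows. -/

section Maximal

variable {K : Type w} [Field K] {V : Type u} [Quiver.{v} V] [Fintype V]
  {I : TwoSidedIdeal (PathAlgebra K V)}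

theorem IsMaximalPath.comp_mem {x y z : V} {m : Quiver.Path x y} (hm : IsMaximalPath I m)
    (q : Quiver.Path y z) (hq : arrows q ≠ []) : ofPath K (m.comp q) ∈ I := by
  obtain ⟨c, e, q, rfl⟩ := exists_eq_toPath_comp q hq
  rw [← Path.comp_assoc]
  exact comp_mem_right _ (hm.2.2 _ e)

theorem IsMaximalPath.comp_mem' {x y z : V} {m : Quiver.Path x y} (hm : IsMaximalPath I m)
    (q : Quiver.Path z x) (hq : arrows q ≠ []) : ofPath K (q.comp m) ∈ I := by
  cases q with
  | nil => simp at hq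
  | cons q e =>
    rw [← Path.comp_toPath_eq_cons, Path.comp_assoc]
    exact comp_mem_left _ (hm.2.1 _ e)

theorem exists_path_of_isChain : ∀ {l : List (Total V)}, l ≠ [] → l.IsChain (Allowed I) →
    ∃ (a b : V) (p : Quiver.Path a b), arrows p = l
  | [], h, _ => absurd rfl h
  | [e], _, _ => ⟨_, _, e.hom.toPath, rfl⟩
  | f :: e :: l, _, h => by
    rw [List.isChain_cons_cons] at h
    obtain ⟨a, b, p, hp⟩ := exists_path_of_isChain (l := e :: l) (by simp) h.2
    obtain ⟨x, y, z, _, f, rfl, rfl, -⟩ := h.1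
    cases p with
    | nil => simp at hp
    | cons p g =>
      rw [arrows_cons, List.cons.injEq] at hp
      cases hp.1
      exact ⟨_, _, (p.cons g).cons f, by simp [hp.2]⟩

variable (hI : IsAlmostGentle I)
include hI

theorem allowed_right_unique (a b c : Total V) (h : Allowed I b a) (h' : Allowed I c a) :
    b = c := by
  obtain ⟨x, y, z, a, b, rfl, rfl, h⟩ := h
  obtain ⟨x, y, z, a, b, ha, rfl, h'⟩ := h'
  cases ha
  exact hI.unique_right _ _ _ h h'

theorem allowed_left_unique (a b c : Total V) (h : Allowed I a b) (h' : Allowed I a c) :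
    b = c := by
  obtain ⟨x, y, z, b, a, rfl, rfl, h⟩ := h
  obtain ⟨x, y, z, c, a, rfl, ha, h'⟩ := h'
  cases ha
  exact hI.unique_left _ _ _ h h'

theorem nil_notMem (x : V) : ofPath K (Path.nil : Quiver.Path x x) ∉ I := by
  simp [notMem_iff hI]

theorem toPath_notMem {x y : V} (a : x ⟶ y) : ofPath K a.toPath ∉ I := by
  simp [notMem_iff hI]

theorem exists_length_bound : ∃ N : ℕ, ∀ (a b : V) (p : Quiver.Path a b), ofPath K p ∉ I →
    p.length < N := by
  obtain ⟨N, -, hN, -⟩ := hI.admissible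
  refine ⟨N, fun a b p hp => ?_⟩
  by_contra! h
  exact hp (hN (ofPath_mem_arrowIdealPow p h))

/-- A repeated arrow closes up a chain that can be traversed arbitrarily often, giving nonzero paths
of unbounded length, which admissibility excludes. -/
theorem nodup_of_isChain {l : List (Total V)} (h : l.IsChain (Allowed I)) : l.Nodup := by
  by_contra hl
  obtain ⟨s, u, v, e, rfl⟩ := exists_repeat_of_not_nodup hl
  obtain ⟨N, hN⟩ := exists_length_bound hI
  have h1 : ((e :: u) ++ [e]).IsChain (Allowed I) := by
    have h2 : ((e :: u) ++ e :: v).IsChain (Allowed I) := by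
      rw [List.append_assoc] at h
      exact h.right_of_append
    have h3 : (((e :: u) ++ [e]) ++ v).IsChain (Allowed I) := by simpa using h2
    exact h3.left_of_append
  -- Each round glues another copy of `e :: u` in front, overlapping in `e`.
  have key : ∀ n : ℕ, ∃ l : List (Total V), n ≤ l.length ∧ (e :: l).IsChain (Allowed I) := by
    intro n
    induction n with
    | zero => exact ⟨[], by simp⟩
    | succ n ih =>
      obtain ⟨l, hl, hc⟩ := ih
      refine ⟨u ++ e :: l, by simp; omega, ?_⟩
      have := isChain_glue (R := Allowed I) (l := e :: u) (m := [e]) (r := l) (by simp) h1 hc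
      simpa using this
  obtain ⟨l, hl, hc⟩ := key N
  obtain ⟨a, b, p, hp⟩ := exists_path_of_isChain (by simp) hc
  have h4 := hN _ _ p ((notMem_iff hI).2 (hp ▸ hc))
  rw [← length_arrows, hp] at h4
  simp at h4
  omega

/-- A chain extending `arrows m` is the list of a nonzero path extending `m`. For trivial `m` this
fails, because an empty list does not remember its vertex. -/
theorem IsMaximalPath.not_isChain_cons {x y : V} {m : Quiver.Path x y} (hm : IsMaximalPath I m)
    (h0 : arrows m ≠ []) (l : List (Total V)) (hl : l ≠ []) :
    ¬ (l ++ arrows m).IsChain (Allowed I) := by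
  intro h
  obtain ⟨a, b, p, hp⟩ := exists_path_of_isChain (by simp [hl]) h
  obtain ⟨c, q, r, rfl, hq, hr⟩ := exists_split p _ _ hp
  obtain ⟨rfl, rfl⟩ := ends_eq_of_arrows_eq q m hq (hq ▸ h0)
  obtain rfl := arrows_injective hq
  refine (notMem_iff hI).2 ?_ (hm.comp_mem r (hr ▸ hl))
  rwa [hp]

theorem IsMaximalPath.not_isChain_append {x y : V} {m : Quiver.Path x y} (hm : IsMaximalPath I m)
    (h0 : arrows m ≠ []) (l : List (Total V)) (hl : l ≠ []) :
    ¬ (arrows m ++ l).IsChain (Allowed I) := by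
  intro h
  obtain ⟨a, b, p, hp⟩ := exists_path_of_isChain (by simp [hl]) h
  obtain ⟨c, q, r, rfl, hq, hr⟩ := exists_split p _ _ hp
  obtain ⟨rfl, rfl⟩ := ends_eq_of_arrows_eq r m hr (hr ▸ h0)
  obtain rfl := arrows_injective hr
  refine (notMem_iff hI).2 ?_ (hm.comp_mem' q (hq ▸ hl))
  rwa [hp]

/-- In a maximal path, what precedes an arrow is the longest possible. -/
theorem IsMaximalPath.prefix_of_eq {x y : V} {m : Quiver.Path x y} (hm : IsMaximalPath I m)
    {s t t' : List (Total V)} {e : Total V} (h : arrows m = s ++ e :: t)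
    (ht' : (e :: t').IsChain (Allowed I)) : t' <+: t := by
  have hc : (s ++ e :: t).IsChain (Allowed I) := h ▸ isChain_of_notMem hm.1
  -- Predecessors of `e` are forced, so `t` and `t'` are comparable; were `t'` strictly longer, the
  -- surplus `l` would extend `m` at its start.
  rcases chain_prefix_or_prefix (allowed_left_unique hI) e t' t ht' hc.right_of_append with
    h' | ⟨l, rfl⟩
  · exact h'
  · rcases eq_or_ne l [] with rfl | hl
    · simp
    · refine absurd ?_ (hm.not_isChain_append hI (by simp [h]) l hl)
      rw [h]
      exact isChain_glue (by simp) hc (by simpa using ht')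

/-- In a maximal path, what follows an arrow is the longest possible. -/
theorem IsMaximalPath.suffix_of_eq {x y : V} {m : Quiver.Path x y} (hm : IsMaximalPath I m)
    {s s' t : List (Total V)} {e : Total V} (h : arrows m = s ++ e :: t)
    (hs' : (s' ++ [e]).IsChain (Allowed I)) : s' <:+ s := by
  have hc : ((s ++ [e]) ++ t).IsChain (Allowed I) := by
    simpa [h] using isChain_of_notMem hm.1
  rcases chain_suffix_or_suffix (allowed_right_unique hI) e s' s hs' hc.left_of_append with
    h' | ⟨l, rfl⟩
  · exact h'
  · rcases eq_or_ne l [] with rfl | hl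
    · simp
    · refine absurd ?_ (hm.not_isChain_cons hI (by simp [h]) l hl)
      have := isChain_glue (l := l) (m := s ++ [e]) (r := t) (by simp) (by simpa using hs') hc
      simpa [h] using this

/-- Two maximal paths with a common arrow agree. -/
theorem IsMaximalPath.arrows_eq {x y x' y' : V} {m : Quiver.Path x y} {m' : Quiver.Path x' y'}
    (hm : IsMaximalPath I m) (hm' : IsMaximalPath I m') {e : Total V} (h : e ∈ arrows m)
    (h' : e ∈ arrows m') : arrows m = arrows m' := by
  obtain ⟨s, t, h⟩ := List.append_of_mem h
  obtain ⟨s', t', h'⟩ := List.append_of_mem h'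
  have hc : ((s ++ [e]) ++ t).IsChain (Allowed I) := by
    simpa [h] using isChain_of_notMem hm.1
  have hc' : ((s' ++ [e]) ++ t').IsChain (Allowed I) := by
    simpa [h'] using isChain_of_notMem hm'.1
  have hd : (s ++ (e :: t)).IsChain (Allowed I) := by simpa using hc
  have hd' : (s' ++ (e :: t')).IsChain (Allowed I) := by simpa using hc'
  have h1 := hm.prefix_of_eq hI h hd'.right_of_append
  have h2 := hm'.prefix_of_eq hI h' hd.right_of_append
  have h3 := hm.suffix_of_eq hI h hc'.left_of_append
  have h4 := hm'.suffix_of_eq hI h' hc.left_of_append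
  rw [h, h', h1.eq_of_length_le h2.length_le, h3.eq_of_length_le h4.length_le]

/-- Every nonzero path is a subpath of a maximal path. -/
theorem exists_maximal {a b : V} (p : Quiver.Path a b) (hp : ofPath K p ∉ I) :
    ∃ (x y : V) (r : Quiver.Path x a) (s : Quiver.Path b y),
      IsMaximalPath I (r.comp (p.comp s)) := by
  obtain ⟨N, hN⟩ := exists_length_bound hI
  -- Here `n` bounds how many more arrows can be added before the length reaches `N`.
  have key : ∀ (n : ℕ) (a b : V) (p : Quiver.Path a b), ofPath K p ∉ I → N ≤ p.length + n →
      ∃ (x y : V) (r : Quiver.Path x a) (s : Quiver.Path b y),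
        IsMaximalPath I (r.comp (p.comp s)) := by
    intro n
    induction n with
    | zero =>
      intro a b p hp h
      have := hN _ _ p hp
      omega
    | succ n ih =>
      intro a b p hp h
      by_cases hm : IsMaximalPath I p
      · exact ⟨a, b, Path.nil, Path.nil, by simpa using hm⟩
      by_cases h1 : ∀ (w : V) (e : w ⟶ a), ofPath K (e.toPath.comp p) ∈ I
      · have h2 : ¬ ∀ (z : V) (e : b ⟶ z), ofPath K (p.comp e.toPath) ∈ I :=
          fun h2 => hm ⟨hp, h1, h2⟩
        push Not at h2
        obtain ⟨z, e, he⟩ := h2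
        obtain ⟨x, y, r, s, hrs⟩ := ih _ _ _ he (by rw [Path.length_comp, Path.length_toPath]; omega)
        exact ⟨x, y, r, e.toPath.comp s, by rwa [Path.comp_assoc] at hrs⟩
      · push Not at h1
        obtain ⟨z, e, he⟩ := h1
        obtain ⟨x, y, r, s, hrs⟩ := ih _ _ _ he (by rw [Path.length_comp, Path.length_toPath]; omega)
        exact ⟨x, y, r.comp e.toPath, s, by rwa [Path.comp_assoc, ← Path.comp_assoc] at hrs⟩
  exact key N a b p hp (by omega)

theorem IsMaximalPath.nodup {x y : V} {m : Quiver.Path x y} (hm : IsMaximalPath I m) :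
    (arrows m).Nodup :=
  nodup_of_isChain hI (isChain_of_notMem hm.1)

theorem ends_eq_of_maximal {a b x y x' y' : V} {p : Quiver.Path a b} (hp : arrows p ≠ [])
    {r : Quiver.Path x a} {s : Quiver.Path b y} {r' : Quiver.Path x' a} {s' : Quiver.Path b y'}
    (hm : IsMaximalPath I (r.comp (p.comp s))) (hm' : IsMaximalPath I (r'.comp (p.comp s'))) :
    x = x' ∧ y = y' := by
  obtain ⟨e, he⟩ := List.exists_mem_of_ne_nil _ hp
  refine ends_eq_of_arrows_eq _ _ (hm.arrows_eq hI hm' (e := e) ?_ ?_) ?_ <;>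
    simp [he, hp]

/-- A common arrow makes the two maximal paths equal, and the absence of repetitions fixes the
position of `p`. A trivial path may lie on several maximal paths; this is where type 1 relations
come from. -/
theorem eq_of_maximal {a b x y : V} {p : Quiver.Path a b} (hp : arrows p ≠ [])
    {r r' : Quiver.Path x a} {s s' : Quiver.Path b y}
    (hm : IsMaximalPath I (r.comp (p.comp s))) (hm' : IsMaximalPath I (r'.comp (p.comp s'))) :
    r = r' ∧ s = s' := by
  obtain ⟨e, l, he⟩ := List.exists_cons_of_ne_nil hp
  have h := hm.arrows_eq hI hm' (e := e) (by simp [he]) (by simp [he])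
  have hn := hm.nodup hI
  simp only [arrows_comp, he, List.append_assoc, List.cons_append] at h hn
  obtain ⟨h1, h2⟩ := append_cons_inj_of_nodup h hn
  exact ⟨arrows_injective (List.append_cancel_left h2), arrows_injective h1⟩

end Maximal

/-! ### Special cycles and consequences of the cycle relations. -/

section Extended

variable {K : Type w} [Field K] {V : Type u} [Quiver.{v} V] [Fintype V]
  {I : TwoSidedIdeal (PathAlgebra K V)}

variable (I) in
/-- An arrow of `Q`, as an arrow of the extended quiver. -/
def inclArrow (e : Total V) : Total (ExtQuiver I) := Total.mk _ _ ((incl I).map e.hom)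

variable (I) in
/-- The new arrow of a maximal path, as an element of the type of all arrows. -/
def beta {x y : V} (m : Quiver.Path x y) (hm : IsMaximalPath I m) : Total (ExtQuiver I) :=
  Total.mk _ _ (newArrow I m hm)

theorem inclArrow_injective : Function.Injective (inclArrow I) := by
  rintro ⟨x, y, e⟩ ⟨x', y', e'⟩ h
  have hx : x = x' := congrArg Total.left h
  have hy : y = y' := congrArg Total.right h
  subst hx hy
  have h' : (Total.mk _ _ ((incl I).map e) : Total (ExtQuiver I)) = Total.mk _ _ ((incl I).map e') := h
  rw [Total.mk.injEq] at h'
  rw [Sum.inl_injective (eq_of_heq h'.2.2)]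

theorem inclArrow_ne_beta (e : Total V) {x y : V} (m : Quiver.Path x y) (hm : IsMaximalPath I m) :
    inclArrow I e ≠ beta I m hm := by
  obtain ⟨a, b, e⟩ := e
  intro h
  have hx : a = y := congrArg Total.left h
  have hy : b = x := congrArg Total.right h
  subst hx hy
  have h' : (Total.mk _ _ ((incl I).map e) : Total (ExtQuiver I)) = Total.mk _ _ (newArrow I m hm) := h
  rw [Total.mk.injEq] at h'
  exact Sum.inl_ne_inr (eq_of_heq h'.2.2)

theorem beta_ends {x y x' y' : V} {m : Quiver.Path x y} {hm : IsMaximalPath I m}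
    {m' : Quiver.Path x' y'} {hm' : IsMaximalPath I m'} (h : beta I m hm = beta I m' hm') :
    x = x' ∧ y = y' :=
  ⟨congrArg Total.right h, congrArg Total.left h⟩

theorem beta_inj {x y : V} {m m' : Quiver.Path x y} {hm : IsMaximalPath I m}
    {hm' : IsMaximalPath I m'} (h : beta I m hm = beta I m' hm') : m = m' := by
  rw [beta, beta, Total.mk.injEq] at h
  exact congrArg Subtype.val (Sum.inr_injective (eq_of_heq h.2.2))

theorem arrows_mapPath {a b : V} (p : Quiver.Path a b) :
    arrows ((incl I).mapPath p) = (arrows p).map (inclArrow I) := by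
  induction p with
  | nil => simp
  | cons p e ih => rw [Prefunctor.mapPath_cons, arrows_cons, ih]; rfl

theorem beta_notMem_map {x y : V} (m : Quiver.Path x y) (hm : IsMaximalPath I m)
    (l : List (Total V)) : beta I m hm ∉ l.map (inclArrow I) := by
  simp [inclArrow_ne_beta]

/-- The path `q β_m p` of the extended quiver. -/
def around {x y c d : V} (m : Quiver.Path x y) (hm : IsMaximalPath I m) (q : Quiver.Path c y)
    (p : Quiver.Path x d) : Quiver.Path ((incl I).obj c) ((incl I).obj d) :=
  ((incl I).mapPath q).comp ((newArrow I m hm).toPath.comp ((incl I).mapPath p))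

theorem arrows_newArrow {x y : V} (m : Quiver.Path x y) (hm : IsMaximalPath I m) :
    arrows (newArrow I m hm).toPath = [beta I m hm] := rfl

theorem arrows_around {x y c d : V} (m : Quiver.Path x y) (hm : IsMaximalPath I m)
    (q : Quiver.Path c y) (p : Quiver.Path x d) : arrows (around m hm q p) =
      (arrows p).map (inclArrow I) ++ beta I m hm :: (arrows q).map (inclArrow I) := by
  rw [around, arrows_comp, arrows_comp, arrows_newArrow, arrows_mapPath, arrows_mapPath,
    List.append_assoc, List.singleton_append]

/-- Cutting `m β_m` inside `m = p q` rotates it to `q β_m p`; this normal form replaces cyclic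
permutations from here on. -/
theorem mem_specialCycles {C : ClosedPath (ExtQuiver I)} : C ∈ specialCycles I ↔
    ∃ (x y c : V) (p : Quiver.Path x c) (q : Quiver.Path c y) (hm : IsMaximalPath I (p.comp q)),
      C = ⟨(incl I).obj c, around (p.comp q) hm q p⟩ := by
  constructor
  · rintro ⟨x, y, m, hm, h⟩
    obtain ⟨k, hk, hn⟩ := List.isRotated_iff_mod.1 h.isRotated
    rw [List.rotate_eq_drop_append_take hk] at hn
    have hC : arrows (maximalCycle I m hm).2 = beta I m hm :: (arrows m).map (inclArrow I) := by
      simp [maximalCycle, arrows_mapPath]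
      rfl
    rw [hC] at hn
    -- In the reversed list `β_m` comes first: rotation by `0` leaves `m` uncut, and rotation by `k
    -- + 1` makes `q` the last `k` arrows of `m`.
    cases k with
    | zero =>
      refine ⟨x, y, x, Path.nil, m, by simpa using hm, closedPath_eq_of_arrows_eq ?_ ?_⟩
      · rw [← hn]
        simp [arrows_around]
      · rw [← hn]
        simp
    | succ k =>
      obtain ⟨c, p, q, rfl, hp, hq⟩ := exists_split m _ _ (List.take_append_drop k _).symm
      refine ⟨x, y, c, p, q, hm, closedPath_eq_of_arrows_eq ?_ ?_⟩
      · rw [← hn, arrows_around]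
        rw [List.drop_succ_cons, List.take_succ_cons, ← List.map_drop, ← List.map_take, ← hp, ← hq]
      · rw [← hn]
        simp
  · rintro ⟨x, y, c, p, q, hm, rfl⟩
    refine ⟨x, y, _, hm, _, _, (incl I).mapPath p,
      ((incl I).mapPath q).comp (newArrow I _ hm).toPath, ?_, ?_⟩
    · simp [maximalCycle]
    · rw [around, Path.comp_assoc]

theorem around_mem_specialCycles {x y c : V} {p : Quiver.Path x c} {q : Quiver.Path c y}
    (hm : IsMaximalPath I (p.comp q)) :
    (⟨(incl I).obj c, around (p.comp q) hm q p⟩ : ClosedPath (ExtQuiver I)) ∈ specialCycles I :=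
  mem_specialCycles.2 ⟨x, y, c, p, q, hm, rfl⟩

variable (I) in
/-- The ideal of relations defined by the special cycles. -/
noncomputable abbrev relIdeal : TwoSidedIdeal (PathAlgebra K (ExtQuiver I)) :=
  cycleIdeal K (specialCycles I) (fun _ => 1)

theorem mem_relIdeal {x : PathAlgebra K (ExtQuiver I)}
    (h : IsCycleRelation K (specialCycles I) (fun _ => 1) x) : x ∈ relIdeal I :=
  TwoSidedIdeal.subset_span h

/-- Either the pair is a type 3 relation, or it is adjacent in some `q β_m p`; the alternative is
phrased with lists so that it can be analysed by position. -/
theorem pair_mem_or {x y z : ExtQuiver I} (a : x ⟶ y) (b : y ⟶ z) :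
    ofPath K (a.toPath.comp b.toPath) ∈ relIdeal I ∨
      ∃ (x' y' c : V) (p : Quiver.Path x' c) (q : Quiver.Path c y')
        (hm : IsMaximalPath I (p.comp q)) (s t : List (Total (ExtQuiver I))),
        s ++ Total.mk _ _ b :: Total.mk _ _ a :: t = (arrows p).map (inclArrow I) ++
          beta I (p.comp q) hm :: (arrows q).map (inclArrow I) := by
  by_cases h : ∀ C ∈ specialCycles I, ¬ IsSubpath (a.toPath.comp b.toPath) (closedPow C.2 1)
  · exact Or.inl (mem_relIdeal (.type3 a b h))
  · push Not at h
    obtain ⟨C, hC, r, s, hrs⟩ := h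
    obtain ⟨x', y', c, p, q, hm, rfl⟩ := mem_specialCycles.1 hC
    refine Or.inr ⟨x', y', c, p, q, hm, arrows s, arrows r, ?_⟩
    have := congrArg arrows hrs
    rw [closedPow, closedPow, Path.nil_comp, arrows_around] at this
    rw [this]
    simp

theorem exists_pair_of_map {l : List (Total V)} {s t : List (Total (ExtQuiver I))} {e f : Total V}
    (h : l.map (inclArrow I) = s ++ inclArrow I f :: inclArrow I e :: t) :
    ∃ s' t', l = s' ++ f :: e :: t' := by
  obtain ⟨s', l', rfl, -, h1⟩ := List.map_eq_append_iff.1 h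
  obtain ⟨f', l', rfl, hf, h2⟩ := List.map_eq_cons_iff.1 h1
  obtain ⟨e', l', rfl, he, -⟩ := List.map_eq_cons_iff.1 h2
  rw [← inclArrow_injective hf, ← inclArrow_injective he]
  exact ⟨s', l', rfl⟩

/-- Two old arrows adjacent in `q β_m p` lie both in `p` or both in `q`, hence are adjacent in `m`,
which is not in `I`. -/
theorem old_pair_mem {x y z : V} (a : x ⟶ y) (b : y ⟶ z)
    (h : ofPath K (a.toPath.comp b.toPath) ∈ I) :
    ofPath K (((incl I).map a).toPath.comp ((incl I).map b).toPath) ∈ relIdeal I := by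
  refine (pair_mem_or _ _).resolve_right ?_
  rintro ⟨x', y', c, p, q, hm, s, t, hst⟩
  have hc := isChain_of_notMem hm.1
  have key : ¬ ∃ s t, arrows (p.comp q) = s ++ Total.mk _ _ b :: Total.mk _ _ a :: t := by
    rintro ⟨s, t, h'⟩
    rw [h'] at hc
    have := hc.right_of_append
    rw [List.isChain_cons_cons] at this
    obtain ⟨x, y, z, a, b, h1, h2, h3⟩ := this.1
    cases h1
    cases h2
    exact h3 h
  rw [arrows_comp] at key
  rcases pair_in_append_cons (b := beta I (p.comp q) hm) hst with h | h | ⟨l, h⟩ | ⟨l, h⟩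
  · exact inclArrow_ne_beta (Total.mk _ _ b) _ _ h.1
  · exact inclArrow_ne_beta (Total.mk _ _ a) _ _ h.1
  · obtain ⟨s', t', h⟩ := exists_pair_of_map (e := Total.mk _ _ a) (f := Total.mk _ _ b) h
    exact key ⟨arrows q ++ s', t', by simp [h]⟩
  · obtain ⟨s', t', h⟩ := exists_pair_of_map (e := Total.mk _ _ a) (f := Total.mk _ _ b) h
    exact key ⟨s', t' ++ arrows p, by simp [h]⟩

/-- The only new arrow on a special cycle determines its maximal path, so the arrow before `β_m` can
only be the last arrow of `m`, at the head of the list. -/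
theorem old_new_pair {x y w : V} (a : w ⟶ y) (m : Quiver.Path x y) (hm : IsMaximalPath I m) :
    ofPath K (((incl I).map a).toPath.comp (newArrow I m hm).toPath) ∈ relIdeal I ∨
      ∃ l, arrows m = Total.mk _ _ a :: l := by
  refine (pair_mem_or _ _).imp_right ?_
  rintro ⟨x', y', c, p, q, hm', s, t, hst⟩
  rcases pair_in_append_cons (b := beta I (p.comp q) hm') hst with h | h | ⟨l, h⟩ | ⟨l, h⟩
  · obtain ⟨h1, h2⟩ := h
    obtain ⟨rfl, rfl⟩ := beta_ends h1
    obtain rfl := beta_inj h1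
    obtain ⟨a', l', hq, ha, -⟩ := List.map_eq_cons_iff.1 h2
    have := inclArrow_injective (a₂ := Total.mk _ _ a) ha
    subst this
    exact ⟨l' ++ arrows p, by simp [hq]⟩
  · exact absurd h.1 (inclArrow_ne_beta (Total.mk _ _ a) _ _)
  · refine absurd ?_ (beta_notMem_map m hm (arrows p))
    rw [h]
    exact List.mem_append_right _ List.mem_cons_self
  · refine absurd ?_ (beta_notMem_map m hm (arrows q))
    rw [h]
    exact List.mem_append_right _ List.mem_cons_self

theorem new_old_pair {x y z : V} (b : x ⟶ z) (m : Quiver.Path x y) (hm : IsMaximalPath I m) :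
    ofPath K ((newArrow I m hm).toPath.comp ((incl I).map b).toPath) ∈ relIdeal I ∨
      ∃ l, arrows m = l ++ [Total.mk _ _ b] := by
  refine (pair_mem_or _ _).imp_right ?_
  rintro ⟨x', y', c, p, q, hm', s, t, hst⟩
  rcases pair_in_append_cons (b := beta I (p.comp q) hm') hst with h | h | ⟨l, h⟩ | ⟨l, h⟩
  · exact absurd h.1 (inclArrow_ne_beta (Total.mk _ _ b) _ _)
  · obtain ⟨h1, h2⟩ := h
    obtain ⟨rfl, rfl⟩ := beta_ends h1
    obtain rfl := beta_inj h1
    obtain ⟨l, l', hp, -, h3⟩ := List.map_eq_append_iff.1 h2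
    obtain ⟨b', l', rfl, hb, h4⟩ := List.map_eq_cons_iff.1 h3
    rw [List.map_eq_nil_iff] at h4
    have := inclArrow_injective (a₂ := Total.mk _ _ b) hb
    subst this h4
    exact ⟨arrows q ++ l, by simp [hp]⟩
  · refine absurd ?_ (beta_notMem_map m hm (arrows p))
    rw [h]
    exact List.mem_append_right _ (List.mem_cons_of_mem _ List.mem_cons_self)
  · refine absurd ?_ (beta_notMem_map m hm (arrows q))
    rw [h]
    exact List.mem_append_right _ (List.mem_cons_of_mem _ List.mem_cons_self)

theorem new_new_pair_mem {x y z : V} (m : Quiver.Path x y) (hm : IsMaximalPath I m)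
    (m' : Quiver.Path z x) (hm' : IsMaximalPath I m') :
    ofPath K ((newArrow I m hm).toPath.comp (newArrow I m' hm').toPath) ∈ relIdeal I := by
  refine (pair_mem_or _ _).resolve_right ?_
  rintro ⟨x', y', c, p, q, hm'', s, t, hst⟩
  rcases pair_in_append_cons (b := beta I (p.comp q) hm'') hst with h | h | ⟨l, h⟩ | ⟨l, h⟩
  · refine beta_notMem_map m hm (arrows q) ?_
    rw [h.2]
    exact List.mem_cons_self
  · refine beta_notMem_map m' hm' (arrows p) ?_
    rw [h.2]
    exact List.mem_append_right _ List.mem_cons_self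
  · refine beta_notMem_map m hm (arrows p) ?_
    rw [h]
    exact List.mem_append_right _ (List.mem_cons_of_mem _ List.mem_cons_self)
  · refine beta_notMem_map m hm (arrows q) ?_
    rw [h]
    exact List.mem_append_right _ (List.mem_cons_of_mem _ List.mem_cons_self)

variable (I) in
/-- The inclusion of quivers as a representation in the path algebra of the extended quiver. -/
noncomputable def inclRep : PathRep V (PathAlgebra K (ExtQuiver I)) where
  vert x := ofPath K (Path.nil : Quiver.Path ((incl I).obj x) ((incl I).obj x))
  arr a := ofPath K ((incl I).map a).toPath
  vert_mul_vert x := by rw [ofPath_mul_ofPath, Path.comp_nil]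
  vert_mul_vert_of_ne x y h := ofPath_mul_ofPath_of_ne _ _ (Ne.symm h)
  sum_vert := (one_def (K := K) (V := ExtQuiver I)).symm
  vert_mul_arr a := by rw [ofPath_mul_ofPath, Path.nil_comp]
  arr_mul_vert a := by rw [ofPath_mul_ofPath, Path.comp_nil]

theorem inclRep_onPath {a b : V} (p : Quiver.Path a b) :
    (inclRep I).onPath p = ofPath K ((incl I).mapPath p) := by
  induction p with
  | nil => rfl
  | cons p e ih =>
    rw [PathRep.onPath, ih]
    exact ofPath_mul_ofPath _ _

variable (I) in
/-- The inclusion of path algebras. -/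
noncomputable def inclAlg : PathAlgebra K V →ₐ[K] PathAlgebra K (ExtQuiver I) :=
  (inclRep I).lift K

@[simp] theorem inclAlg_ofPath {a b : V} (p : Quiver.Path a b) :
    inclAlg I (ofPath K p) = ofPath K ((incl I).mapPath p) := by
  rw [inclAlg, PathRep.lift_ofPath, inclRep_onPath]

variable (hI : IsAlmostGentle I)
include hI

theorem inclAlg_mem {x : PathAlgebra K V} (hx : x ∈ I) : inclAlg I x ∈ relIdeal I := by
  obtain ⟨R, hR, hIR⟩ := hI.generated
  have hle : I ≤ TwoSidedIdeal.comap (inclAlg I) (relIdeal I) := by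
    refine hIR.le.trans (TwoSidedIdeal.span_le.2 ?_)
    rintro x ⟨⟨a, b, p⟩, hp, rfl⟩
    rw [SetLike.mem_coe, TwoSidedIdeal.mem_comap, inclAlg_ofPath]
    have hpI : ofPath K p ∈ I := hIR.ge (TwoSidedIdeal.subset_span ⟨_, hp, rfl⟩)
    have hlen := hR _ hp
    match b, p, hlen with
    | _, .cons (.cons .nil e) e', _ => exact old_pair_mem e e' hpI
  exact (TwoSidedIdeal.mem_comap _).1 (hle hx)

theorem mapPath_mem {a b : V} {p : Quiver.Path a b} (hp : ofPath K p ∈ I) :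
    ofPath K ((incl I).mapPath p) ∈ relIdeal I := by
  rw [← inclAlg_ofPath]
  exact inclAlg_mem hI hp

/-- If the product survives, the last arrow of `q` is that of `m`; predecessors being forced, all of
`q` is then a final segment of `m`. -/
theorem mem_or_exists_comp_left {x y c : V} (m : Quiver.Path x y) (hm : IsMaximalPath I m)
    (q : Quiver.Path c y) :
    ofPath K (((incl I).mapPath q).comp (newArrow I m hm).toPath) ∈ relIdeal I ∨
      ∃ r : Quiver.Path x c, m = r.comp q := by
  by_cases hq : ofPath K q ∈ I
  · exact Or.inl (comp_mem_right _ (mapPath_mem hI hq))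
  have hc := isChain_of_notMem hq
  cases q with
  | nil => exact Or.inr ⟨m, rfl⟩
  | cons q e =>
    rcases old_new_pair e m hm with h | ⟨l, h⟩
    · exact Or.inl (comp_mem_left ((incl I).mapPath q) h)
    · refine Or.inr (exists_eq_comp_of_prefix ?_)
      rw [h, arrows_cons]
      simpa using hm.prefix_of_eq hI (s := []) h hc

theorem mem_or_exists_comp_right {x y d : V} (m : Quiver.Path x y) (hm : IsMaximalPath I m)
    (p : Quiver.Path x d) :
    ofPath K ((newArrow I m hm).toPath.comp ((incl I).mapPath p)) ∈ relIdeal I ∨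
      ∃ r : Quiver.Path d y, m = p.comp r := by
  by_cases hp : ofPath K p ∈ I
  · exact Or.inl (comp_mem_left _ (mapPath_mem hI hp))
  have hc := isChain_of_notMem hp
  by_cases h0 : arrows p = []
  · exact Or.inr (exists_eq_comp_of_suffix (by simp [h0]))
  obtain ⟨c, e, p, rfl⟩ := exists_eq_toPath_comp p h0
  rcases new_old_pair e m hm with h | ⟨l, h⟩
  · left
    rw [Prefunctor.mapPath_comp, Prefunctor.mapPath_toPath, ← Path.comp_assoc]
    exact comp_mem_right _ h
  · refine Or.inr (exists_eq_comp_of_suffix ?_)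
    rw [arrows_comp] at hc
    obtain ⟨l', hl'⟩ := hm.suffix_of_eq hI (t := []) h hc
    exact ⟨l', by rw [h, ← hl', arrows_comp, arrows_toPath, List.append_assoc]⟩

theorem around_mem_or {x y c d : V} (m : Quiver.Path x y) (hm : IsMaximalPath I m)
    (q : Quiver.Path c y) (p : Quiver.Path x d) :
    ofPath K (around m hm q p) ∈ relIdeal I ∨
      ∃ z : Quiver.Path d c, m = p.comp (z.comp q) := by
  rcases mem_or_exists_comp_left hI m hm q with h | ⟨r, rfl⟩
  · left
    rw [around, ← Path.comp_assoc]
    exact comp_mem_right _ h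
  rcases mem_or_exists_comp_right hI _ hm p with h | ⟨r', hr'⟩
  · exact Or.inl (comp_mem_left _ h)
  -- Now `p` is initial and `q` final in `m`; the question is whether they overlap.
  by_cases hlen : q.length ≤ r'.length
  · right
    have h1 : arrows q <+: arrows r' := by
      have h := congrArg arrows hr'
      rw [arrows_comp, arrows_comp] at h
      exact List.prefix_of_prefix_length_le ⟨_, rfl⟩ ⟨_, h.symm⟩ (by simpa using hlen)
    obtain ⟨z, rfl⟩ := exists_eq_comp_of_prefix h1
    exact ⟨z, hr'⟩
  · left
    have h1 : arrows r' <+: arrows q := by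
      have h := congrArg arrows hr'
      rw [arrows_comp, arrows_comp] at h
      exact List.prefix_of_prefix_length_le ⟨_, rfl⟩ ⟨_, h⟩ (by simpa using (not_le.1 hlen).le)
    obtain ⟨z, rfl⟩ := exists_eq_comp_of_prefix h1
    have hz : arrows z ≠ [] := by
      intro h
      rw [arrows_eq_nil] at h
      rw [Path.length_comp] at hlen
      omega
    rw [← Path.comp_assoc, Path.comp_inj_left] at hr'
    subst hr'
    -- With overlap `z`, so `p = r z` and `q = z r'`, the path `q β_m p` is the special cycle `q β_m
    -- r` followed by `z`, which starts with the first arrow of that cycle: type 2.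
    obtain ⟨k, e, z, rfl⟩ := exists_eq_toPath_comp z hz
    have h2 := mem_relIdeal (I := I) (.type2 (K := K) _ (around_mem_specialCycles hm) ((incl I).map e)
      (((incl I).mapPath (z.comp r')).comp ((newArrow I _ hm).toPath.comp ((incl I).mapPath r)))
      (by simp [around]))
    have h3 := comp_mem_right ((incl I).mapPath z) h2
    simpa [around, closedPow, -Path.comp_toPath_eq_cons] using h3

/-- If neither half vanishes, `p` is initial in `m` and final in `m'`. A trivial `p` leaves two
adjacent new arrows, a type 3 relation; otherwise uniqueness gives `m = p = m'`, and `β_m m β_m` is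
a type 2 relation. -/
theorem new_old_new_mem {x y x' y' : V} (m : Quiver.Path x y) (hm : IsMaximalPath I m)
    (m' : Quiver.Path x' y') (hm' : IsMaximalPath I m') (p : Quiver.Path x y') :
    ofPath K ((newArrow I m hm).toPath.comp
      (((incl I).mapPath p).comp (newArrow I m' hm').toPath)) ∈ relIdeal I := by
  rcases mem_or_exists_comp_right hI m hm p with h | ⟨r, hr⟩
  · rw [← Path.comp_assoc]
    exact comp_mem_right _ h
  rcases mem_or_exists_comp_left hI m' hm' p with h | ⟨r', hr'⟩
  · exact comp_mem_left _ h
  by_cases h0 : arrows p = []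
  · cases p with
    | nil =>
      rw [Prefunctor.mapPath_nil, Path.nil_comp]
      exact new_new_pair_mem m hm m' hm'
    | cons p e => simp at h0
  have h1 : IsMaximalPath I (Path.nil.comp (p.comp r)) := by rwa [Path.nil_comp, ← hr]
  have h2 : IsMaximalPath I (r'.comp (p.comp Path.nil)) := by rwa [Path.comp_nil, ← hr']
  obtain ⟨rfl, rfl⟩ := ends_eq_of_maximal hI h0 h1 h2
  obtain ⟨h3, rfl⟩ := eq_of_maximal hI h0 h1 h2
  subst h3
  rw [Path.comp_nil] at hr
  rw [Path.nil_comp] at hr'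
  subst hr'
  subst hr
  have h3 := mem_relIdeal (I := I) (.type2 (K := K) _
    (around_mem_specialCycles (p := m) (q := Path.nil) (by simpa using hm)) (newArrow I m hm)
    ((incl I).mapPath m) (by simp [around]))
  simpa [around, closedPow, -Path.comp_toPath_eq_cons] using h3

end Extended

/-! ### The dual basis of the nonzero paths, and the bimodule action on it. -/

section Dual

variable {K : Type w} [Field K] {V : Type u} [Quiver.{v} V] [Fintype V]
  {I : TwoSidedIdeal (PathAlgebra K V)}

/-- A linear form, as an element of the dual bimodule. -/
def DualBimodule.ofLinear {A : Type u} [Ring A] [Algebra K A] (f : A →ₗ[K] K) :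
    DualBimodule K A := f

/-- An element of the dual bimodule, as a linear form. -/
def DualBimodule.toLinear {A : Type u} [Ring A] [Algebra K A] (f : DualBimodule K A) :
    A →ₗ[K] K := f

theorem DualBimodule.toLinear_apply {A : Type u} [Ring A] [Algebra K A] (f : DualBimodule K A)
    (x : A) : f.toLinear x = f x := rfl

theorem DualBimodule.ofLinear_apply {A : Type u} [Ring A] [Algebra K A] (f : A →ₗ[K] K)
    (x : A) : DualBimodule.ofLinear f x = f x := rfl

open Classical in
variable (I) in
/-- The linear form on `KQ/I` dual to a path that is not in `I` (and `0` if the coefficient of the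
path is not defined on `KQ/I`). -/
noncomputable def dualForm (p : Σ a : V, Σ b : V, Quiver.Path a b) :
    DualBimodule K (BoundAlgebra I) :=
  if h : ∀ x ∈ I, coeff K p x = 0 then
    DualBimodule.ofLinear (liftBound (coeff K p) h)
  else 0

theorem DualBimodule.sum_apply {ι : Type*} (s : Finset ι)
    (g : ι → DualBimodule K (BoundAlgebra I)) (x : BoundAlgebra I) :
    (∑ i ∈ s, g i) x = ∑ i ∈ s, g i x := by
  classical
  induction s using Finset.induction_on with
  | empty => simp
  | insert i s hi ih => rw [Finset.sum_insert hi, Finset.sum_insert hi, DualBimodule.add_apply, ih]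

variable (hI : IsAlmostGentle I)
include hI

open Classical in
theorem dualForm_toBound {a b c d : V} {p : Quiver.Path a b} (hp : ofPath K p ∉ I)
    (q : Quiver.Path c d) : dualForm I ⟨a, b, p⟩ (toBound I (ofPath K q)) =
      if (⟨c, d, q⟩ : Σ a : V, Σ b : V, Quiver.Path a b) = ⟨a, b, p⟩ then 1 else 0 := by
  have h : ∀ x ∈ I, coeff K ⟨a, b, p⟩ x = 0 :=
    fun x hx => coeff_eq_zero hI (isChain_of_notMem hp) hx
  rw [dualForm, dif_pos h, DualBimodule.ofLinear_apply, liftBound_toBound, coeff_ofPath]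

/-- The dual forms separate the nonzero paths, which are therefore linearly independent in a finite
dimensional algebra. -/
theorem finite_nonzero : {p : Σ a : V, Σ b : V, Quiver.Path a b | ofPath K p.2.2 ∉ I}.Finite := by
  classical
  have := hI.finiteDimensional
  have hli : LinearIndependent K
      (fun p : {p : Σ a : V, Σ b : V, Quiver.Path a b | ofPath K p.2.2 ∉ I} =>
        toBound I (ofPath K p.1.2.2)) := by
    rw [linearIndependent_iff']
    rintro s g hg ⟨p, hp⟩ his
    have h := congrArg (dualForm I p).toLinear hg
    rw [map_sum, Finset.sum_eq_single ⟨p, hp⟩, map_zero, _root_.map_smul,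
      DualBimodule.toLinear_apply, dualForm_toBound hI hp, if_pos rfl, smul_eq_mul, mul_one] at h
    · exact h
    · rintro ⟨q, hq⟩ - hne
      rw [_root_.map_smul, DualBimodule.toLinear_apply, dualForm_toBound hI hp, if_neg, smul_zero]
      exact fun h => hne (Subtype.ext h)
    · exact fun h => absurd his h
  exact hli.finite

/-- The set of paths that are not in `I`. -/
noncomputable def nonzeroPaths : Finset (Σ a : V, Σ b : V, Quiver.Path a b) :=
  (finite_nonzero hI).toFinset

theorem mem_nonzeroPaths {p : Σ a : V, Σ b : V, Quiver.Path a b} :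
    p ∈ nonzeroPaths hI ↔ ofPath K p.2.2 ∉ I := by
  simp [nonzeroPaths]

theorem eq_sum_dualForm (f : DualBimodule K (BoundAlgebra I)) :
    f = ∑ p ∈ nonzeroPaths hI, f (toBound I (ofPath K p.2.2)) • dualForm I p := by
  classical
  apply dualBimodule_ext
  intro a b q
  rw [DualBimodule.sum_apply]
  simp only [DualBimodule.smul_apply]
  by_cases hq : ofPath K q ∈ I
  · rw [toBound_eq_zero.2 hq]
    simp [DualBimodule.map_zero]
  · rw [Finset.sum_eq_single ⟨a, b, q⟩]
    · rw [dualForm_toBound hI hq, if_pos rfl, smul_eq_mul, mul_one]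
    · intro p hp hne
      rw [dualForm_toBound hI ((mem_nonzeroPaths hI).1 hp), if_neg (Ne.symm hne), smul_zero]
    · exact fun h => absurd ((mem_nonzeroPaths hI).2 hq) h

/-- For paths `p`, `z`, `q`, the form `x ↦ (p z q)^∨ (p x q)` is `z^∨`. -/
theorem smul_dualForm_comp {x y d c : V} (p : Quiver.Path x d) (z : Quiver.Path d c)
    (q : Quiver.Path c y) (h : ofPath K (p.comp (z.comp q)) ∉ I) :
    toBound I (ofPath K q) • (MulOpposite.op (toBound I (ofPath K p)) •
      dualForm I ⟨x, y, p.comp (z.comp q)⟩) = dualForm I ⟨d, c, z⟩ := by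
  have hz : ofPath K z ∉ I := fun hz => h (comp_mem_left _ (comp_mem_right _ hz))
  apply dualBimodule_ext
  intro a b k
  rw [DualBimodule.left_smul_apply, DualBimodule.right_smul_apply, MulOpposite.unop_op,
    ← map_mul, ← map_mul, dualForm_toBound hI hz]
  by_cases hb : c = b
  · subst hb
    by_cases ha : a = d
    · subst ha
      rw [ofPath_mul_ofPath, ofPath_mul_ofPath, dualForm_toBound hI h]
      congr 1
      simp
    · rw [ofPath_mul_ofPath, ofPath_mul_ofPath_of_ne _ _ ha, map_zero, DualBimodule.map_zero,
        if_neg]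
      rintro ⟨⟩
      exact ha rfl
  · rw [ofPath_mul_ofPath_of_ne _ _ hb, mul_zero, map_zero, DualBimodule.map_zero, if_neg]
    rintro ⟨⟩
    exact hb rfl

/-- The form evaluated at a path `k` is the coefficient of `m` in `p k q`. -/
theorem smul_dualForm_eq_zero {x y d c : V} (p : Quiver.Path x d) (m : Quiver.Path x y)
    (q : Quiver.Path c y) (hm : ofPath K m ∉ I) (h : ∀ z : Quiver.Path d c, m ≠ p.comp (z.comp q)) :
    toBound I (ofPath K q) • (MulOpposite.op (toBound I (ofPath K p)) •
      dualForm I ⟨x, y, m⟩) = 0 := by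
  apply dualBimodule_ext
  intro a b k
  rw [DualBimodule.left_smul_apply, DualBimodule.right_smul_apply, MulOpposite.unop_op,
    ← map_mul, ← map_mul, DualBimodule.zero_apply]
  by_cases hb : c = b
  · subst hb
    by_cases ha : a = d
    · subst ha
      rw [ofPath_mul_ofPath, ofPath_mul_ofPath, dualForm_toBound hI hm, if_neg]
      intro h'
      simp only [Sigma.mk.injEq, heq_eq_eq, true_and] at h'
      exact h k h'.symm
    · rw [ofPath_mul_ofPath, ofPath_mul_ofPath_of_ne _ _ ha, map_zero, DualBimodule.map_zero]
  · rw [ofPath_mul_ofPath_of_ne _ _ hb, mul_zero, map_zero, DualBimodule.map_zero]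

end Dual

/-! ### The canonical map to the trivial extension. -/

section Canonical

variable {K : Type w} [Field K] {V : Type u} [Quiver.{v} V] [Fintype V]
  {I : TwoSidedIdeal (PathAlgebra K V)}

variable (I) in
/-- The vertex of `Q` underlying a vertex of the extended quiver. -/
def base (x : ExtQuiver I) : V := x

variable (I) in
/-- The images of the trivial paths in the trivial extension. -/
noncomputable def trivVert (x : V) : TrivialExtension K (BoundAlgebra I) :=
  TrivSqZeroExt.inl (toBound I (ofPath K (Path.nil : Quiver.Path x x)))

variable (I) in
/-- The images of the arrows of the extended quiver in the trivial extension. -/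
noncomputable def trivArr {x y : ExtQuiver I} (a : x ⟶ y) :
    TrivialExtension K (BoundAlgebra I) :=
  Sum.elim
    (fun a : base I x ⟶ base I y => TrivSqZeroExt.inl (toBound I (ofPath K a.toPath)))
    (fun m : {m : Quiver.Path (base I y) (base I x) // IsMaximalPath I m} =>
      TrivSqZeroExt.inr (dualForm I ⟨_, _, m.1⟩)) a

theorem trivArr_incl {x y : V} (a : x ⟶ y) : trivArr I ((incl I).map a) =
    TrivSqZeroExt.inl (toBound I (ofPath K a.toPath)) := rfl

theorem trivArr_newArrow {x y : V} (m : Quiver.Path x y) (hm : IsMaximalPath I m) :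
    trivArr I (newArrow I m hm) = TrivSqZeroExt.inr (dualForm I ⟨x, y, m⟩) := rfl

/-- An arrow of the extended quiver is an old one or a new one. -/
theorem ext_arrow_cases {P : ∀ {x y : ExtQuiver I}, (x ⟶ y) → Prop}
    (old : ∀ {x y : V} (a : x ⟶ y), P ((incl I).map a))
    (new : ∀ {x y : V} (m : Quiver.Path x y) (hm : IsMaximalPath I m), P (newArrow I m hm))
    {x y : ExtQuiver I} (a : x ⟶ y) : P a := by
  rcases a with a | ⟨m, hm⟩
  · exact old a
  · exact new m hm

theorem inl_mul_inl {A : Type u} [Ring A] [Algebra K A] (a b : A) :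
    (TrivSqZeroExt.inl a * TrivSqZeroExt.inl b : TrivialExtension K A) =
      TrivSqZeroExt.inl (a * b) :=
  (TrivSqZeroExt.inl_mul _ a b).symm

theorem inl_mul_inr_mul_inl {A : Type u} [Ring A] [Algebra K A] (a b : A) (f : DualBimodule K A) :
    (TrivSqZeroExt.inl a * (TrivSqZeroExt.inr f * TrivSqZeroExt.inl b) : TrivialExtension K A) =
      TrivSqZeroExt.inr (a • (MulOpposite.op b • f)) := by
  rw [TrivSqZeroExt.inr_mul_inl, TrivSqZeroExt.inl_mul_inr]

theorem trivVert_mul_incl {x y : V} (a : x ⟶ y) :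
    trivVert I x * trivArr I ((incl I).map a) = trivArr I ((incl I).map a) := by
  rw [trivArr_incl, trivVert, inl_mul_inl, ← map_mul, ofPath_mul_ofPath,
    Path.nil_comp]

theorem incl_mul_trivVert {x y : V} (a : x ⟶ y) :
    trivArr I ((incl I).map a) * trivVert I y = trivArr I ((incl I).map a) := by
  rw [trivArr_incl, trivVert, inl_mul_inl, ← map_mul, ofPath_mul_ofPath,
    Path.comp_nil]

theorem sum_trivVert : ∑ x : V, trivVert I x = 1 := by
  simp only [trivVert]
  rw [← TrivSqZeroExt.inl_sum, ← map_sum, ← one_def, map_one, TrivSqZeroExt.inl_one]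

theorem trivVert_mul_trivVert (x : V) : trivVert I x * trivVert I x = trivVert I x := by
  rw [trivVert, inl_mul_inl, ← map_mul, ofPath_mul_ofPath, Path.comp_nil]

theorem trivVert_mul_trivVert_of_ne (x y : V) (h : x ≠ y) : trivVert I x * trivVert I y = 0 := by
  rw [trivVert, trivVert, inl_mul_inl, ← map_mul, ofPath_mul_ofPath_of_ne _ _ h.symm,
    map_zero, TrivSqZeroExt.inl_zero]

variable (hI : IsAlmostGentle I)
include hI

theorem trivVert_mul_newArrow_mul {x y : V} (m : Quiver.Path x y) (hm : IsMaximalPath I m) :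
    trivVert I y * (trivArr I (newArrow I m hm) * trivVert I x) = trivArr I (newArrow I m hm) := by
  have := smul_dualForm_comp hI Path.nil m Path.nil (by simpa using hm.1)
  rw [Path.nil_comp, Path.comp_nil] at this
  rw [trivArr_newArrow, trivVert, trivVert, inl_mul_inr_mul_inl, this]

theorem trivVert_mul_newArrow {x y : V} (m : Quiver.Path x y) (hm : IsMaximalPath I m) :
    trivVert I y * trivArr I (newArrow I m hm) = trivArr I (newArrow I m hm) := by
  rw [← trivVert_mul_newArrow_mul hI m hm, ← mul_assoc, trivVert_mul_trivVert]

theorem newArrow_mul_trivVert {x y : V} (m : Quiver.Path x y) (hm : IsMaximalPath I m) :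
    trivArr I (newArrow I m hm) * trivVert I x = trivArr I (newArrow I m hm) := by
  rw [← trivVert_mul_newArrow_mul hI m hm, mul_assoc, mul_assoc, trivVert_mul_trivVert]

/-- The representation of the extended quiver in the trivial extension. -/
noncomputable def trivRep : PathRep (ExtQuiver I) (TrivialExtension K (BoundAlgebra I)) where
  vert x := trivVert I (base I x)
  arr a := trivArr I a
  vert_mul_vert _ := trivVert_mul_trivVert _
  vert_mul_vert_of_ne _ _ h := trivVert_mul_trivVert_of_ne _ _ h
  sum_vert := sum_trivVert (I := I)
  vert_mul_arr a := ext_arrow_cases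
    (P := fun {x y} (a : x ⟶ y) => trivVert I (base I x) * trivArr I a = trivArr I a)
    trivVert_mul_incl (trivVert_mul_newArrow hI) a
  arr_mul_vert a := ext_arrow_cases
    (P := fun {x y} (a : x ⟶ y) => trivArr I a * trivVert I (base I y) = trivArr I a)
    incl_mul_trivVert (newArrow_mul_trivVert hI) a

/-- The canonical map from the path algebra of the extended quiver to the trivial extension. -/
noncomputable def canonical :
    PathAlgebra K (ExtQuiver I) →ₐ[K] TrivialExtension K (BoundAlgebra I) :=
  (trivRep hI).lift K

theorem canonical_newArrow {x y : V} (m : Quiver.Path x y) (hm : IsMaximalPath I m) :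
    canonical hI (ofPath K (newArrow I m hm).toPath) =
      TrivSqZeroExt.inr (dualForm I ⟨x, y, m⟩) := by
  rw [canonical, PathRep.lift_ofPath, PathRep.onPath_toPath]
  rfl

theorem canonical_mapPath {x y : V} (p : Quiver.Path x y) :
    canonical hI (ofPath K ((incl I).mapPath p)) = TrivSqZeroExt.inl (toBound I (ofPath K p)) := by
  rw [canonical, PathRep.lift_ofPath]
  induction p with
  | nil => rfl
  | cons p e ih =>
    rw [Prefunctor.mapPath_cons, PathRep.onPath, ih, ← Path.comp_toPath_eq_cons,
      ← ofPath_mul_ofPath, map_mul, ← inl_mul_inl]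
    rfl

theorem canonical_isCanonical : IsCanonical I (canonical hI) where
  vertex _ := canonical_mapPath hI Path.nil
  arrow a := canonical_mapPath hI a.toPath
  newArrow m hm := ⟨_, canonical_newArrow hI m hm, fun p _ => dualForm_toBound hI hm.1 p⟩

theorem canonical_inclAlg (x : PathAlgebra K V) :
    canonical hI (inclAlg I x) = TrivSqZeroExt.inl (toBound I x) := by
  induction x using pathAlgebra_induction with
  | zero => simp
  | add x y hx hy => simp only [_root_.map_add, hx, hy, TrivSqZeroExt.inl_add]
  | path r a b p =>
    rw [_root_.map_smul, _root_.map_smul, _root_.map_smul, inclAlg_ofPath, canonical_mapPath,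
      TrivSqZeroExt.inl_smul]

theorem canonical_around {x y c d : V} (m : Quiver.Path x y) (hm : IsMaximalPath I m)
    (q : Quiver.Path c y) (p : Quiver.Path x d) : canonical hI (ofPath K (around m hm q p)) =
      TrivSqZeroExt.inr (toBound I (ofPath K q) • (MulOpposite.op (toBound I (ofPath K p)) •
        dualForm I ⟨x, y, m⟩)) := by
  rw [around, ← ofPath_mul_ofPath, ← ofPath_mul_ofPath, map_mul, map_mul, canonical_mapPath,
    canonical_mapPath, canonical_newArrow, inl_mul_inr_mul_inl]

theorem canonical_around_comp {x y c d : V} (m : Quiver.Path x y) (hm : IsMaximalPath I m)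
    (q : Quiver.Path c y) (p : Quiver.Path x d) (z : Quiver.Path d c) (h : m = p.comp (z.comp q)) :
    canonical hI (ofPath K (around m hm q p)) = TrivSqZeroExt.inr (dualForm I ⟨d, c, z⟩) := by
  subst h
  rw [canonical_around, smul_dualForm_comp hI _ _ _ hm.1]

theorem canonical_around_eq_zero {x y c d : V} (m : Quiver.Path x y) (hm : IsMaximalPath I m)
    (q : Quiver.Path c y) (p : Quiver.Path x d) (h : ∀ z : Quiver.Path d c, m ≠ p.comp (z.comp q)) :
    canonical hI (ofPath K (around m hm q p)) = 0 := by
  rw [canonical_around, smul_dualForm_eq_zero hI _ _ _ hm.1 h, TrivSqZeroExt.inr_zero]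

/-- All special cycles at a vertex have the same image. -/
theorem canonical_special {v : V} (C : Quiver.Path ((incl I).obj v) ((incl I).obj v))
    (hC : (⟨(incl I).obj v, C⟩ : ClosedPath (ExtQuiver I)) ∈ specialCycles I) :
    canonical hI (ofPath K C) = TrivSqZeroExt.inr (dualForm I ⟨v, v, Path.nil⟩) := by
  obtain ⟨x, y, c, p, q, hm, h⟩ := mem_specialCycles.1 hC
  obtain rfl : v = c := congrArg Sigma.fst h
  obtain rfl := eq_of_heq (Sigma.mk.inj h).2
  -- The complementary factor of a full cycle is the trivial path, whichever cycle it is.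
  exact canonical_around_comp hI _ hm q p Path.nil (by rw [Path.nil_comp])

end Canonical

/-! ### Surjectivity and kernel of the canonical map. -/

section Kernel

variable {K : Type w} [Field K] {V : Type u} [Quiver.{v} V] [Fintype V]
  {I : TwoSidedIdeal (PathAlgebra K V)}

@[simp] theorem closedPow_one {x : V} (C : Quiver.Path x x) : closedPow C 1 = C := by
  rw [closedPow, closedPow, Path.nil_comp]

theorem around_special {x y c : V} {m : Quiver.Path x y} {p : Quiver.Path x c}
    {q : Quiver.Path c y} (hm : IsMaximalPath I m) (h : m = p.comp q) :
    (⟨(incl I).obj c, around m hm q p⟩ : ClosedPath (ExtQuiver I)) ∈ specialCycles I := by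
  subst h
  exact around_mem_specialCycles hm

theorem inr_mul_inr_eq_zero {A : Type u} [Ring A] [Algebra K A] (f g : DualBimodule K A) :
    (TrivSqZeroExt.inr f * TrivSqZeroExt.inr g : TrivialExtension K A) = 0 :=
  TrivSqZeroExt.inr_mul_inr A f g

/-- Every path of the extended quiver passes through no, one, or at least two new arrows. -/
theorem ext_path_cases {x y : ExtQuiver I} (w : Quiver.Path x y) :
    (∃ p : Quiver.Path (base I x) (base I y), w = (incl I).mapPath p) ∨
    (∃ (a b : V) (m : Quiver.Path a b) (hm : IsMaximalPath I m) (q : Quiver.Path (base I x) b)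
      (p : Quiver.Path a (base I y)), w = around m hm q p) ∨
    ∃ (a b a' b' : V) (m : Quiver.Path a b) (hm : IsMaximalPath I m) (m' : Quiver.Path a' b')
      (hm' : IsMaximalPath I m') (p : Quiver.Path a b')
      (r : Quiver.Path x ((incl I).obj b)) (s : Quiver.Path ((incl I).obj a') y),
      w = r.comp (((newArrow I m hm).toPath.comp
        (((incl I).mapPath p).comp (newArrow I m' hm').toPath)).comp s) := by
  induction w with
  | nil => exact Or.inl ⟨Path.nil, rfl⟩
  | @cons y z w e ih =>
    rcases ih with ⟨p, rfl⟩ | ⟨a, b, m, hm, q, p, rfl⟩ |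
      ⟨a, b, a', b', m, hm, m', hm', p, r, s, rfl⟩
    · rcases e with e | ⟨m, hm⟩
      · exact Or.inl ⟨p.cons e, rfl⟩
      · exact Or.inr (Or.inl ⟨z, y, m, hm, p, Path.nil, rfl⟩)
    · rcases e with e | ⟨m', hm'⟩
      · exact Or.inr (Or.inl ⟨a, b, m, hm, q, p.cons e, rfl⟩)
      · exact Or.inr (Or.inr ⟨a, b, z, y, m, hm, m', hm', p, (incl I).mapPath q, Path.nil, rfl⟩)
    · exact Or.inr (Or.inr ⟨a, b, a', b', m, hm, m', hm', p, r, s.cons e, rfl⟩)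

/-- `w` is a path `s β_m r` with `m = r p s`. -/
def IsComplement (p : Σ a : V, Σ b : V, Quiver.Path a b) (w : PathAlgebra K (ExtQuiver I)) :
    Prop :=
  ∃ (x y : V) (r : Quiver.Path x p.1) (s : Quiver.Path p.2.1 y)
    (hm : IsMaximalPath I (r.comp (p.2.2.comp s))),
    w = ofPath K (around (r.comp (p.2.2.comp s)) hm s r)

open Classical in
variable (I) in
/-- A path complementary to `p` in a special cycle. -/
noncomputable def complement (p : Σ a : V, Σ b : V, Quiver.Path a b) :
    PathAlgebra K (ExtQuiver I) :=
  if h : ∃ w : PathAlgebra K (ExtQuiver I), IsComplement p w then h.choose else 0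

variable (hI : IsAlmostGentle I)
include hI

theorem complement_spec {p : Σ a : V, Σ b : V, Quiver.Path a b} (hp : ofPath K p.2.2 ∉ I) :
    IsComplement p (complement I p) := by
  obtain ⟨x, y, r, s, hm⟩ := exists_maximal hI p.2.2 hp
  have h : ∃ w : PathAlgebra K (ExtQuiver I), IsComplement p w := ⟨_, x, y, r, s, hm, rfl⟩
  rw [complement, dif_pos h]
  exact h.choose_spec

theorem canonical_complement {p : Σ a : V, Σ b : V, Quiver.Path a b} (hp : ofPath K p.2.2 ∉ I) :
    canonical hI (complement I p) = TrivSqZeroExt.inr (dualForm I p) := by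
  obtain ⟨x, y, r, s, hm, h⟩ := complement_spec hI hp
  rw [h, canonical_around_comp hI _ hm s r p.2.2 rfl]

/-- Chosen complements thus give a linear section of the canonical map over `D(A)`. -/
theorem canonical_sum_complement (f : DualBimodule K (BoundAlgebra I)) :
    canonical hI (∑ p ∈ nonzeroPaths hI, f (toBound I (ofPath K p.2.2)) • complement I p) =
      TrivSqZeroExt.inr f := by
  conv_rhs => rw [eq_sum_dualForm hI f]
  rw [map_sum, TrivSqZeroExt.inr_sum]
  refine Finset.sum_congr rfl fun p hp => ?_
  rw [_root_.map_smul, canonical_complement hI ((mem_nonzeroPaths hI).1 hp), TrivSqZeroExt.inr_smul]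

theorem canonical_surjective : Function.Surjective (canonical hI) := by
  intro t
  obtain ⟨x, hx⟩ := toBound_surjective I t.fst
  refine ⟨inclAlg I x +
    ∑ p ∈ nonzeroPaths hI, t.snd (toBound I (ofPath K p.2.2)) • complement I p, ?_⟩
  rw [_root_.map_add, canonical_sum_complement, canonical_inclAlg, hx,
    TrivSqZeroExt.inl_fst_add_inr_snd_eq]

/-- A path starting with `a` is never trivial. As special cycles go to the dual of a trivial path,
this accounts for the type 2 relations. -/
theorem op_smul_dualForm_nil {x y : V} (a : x ⟶ y) :
    MulOpposite.op (toBound I (ofPath K a.toPath)) • dualForm I ⟨x, x, Path.nil⟩ = 0 := by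
  apply dualBimodule_ext
  intro c d k
  rw [DualBimodule.right_smul_apply, MulOpposite.unop_op, ← map_mul, DualBimodule.zero_apply]
  by_cases hc : c = y
  · subst hc
    rw [ofPath_mul_ofPath, dualForm_toBound hI (nil_notMem hI x), if_neg]
    intro h
    have h1 := congrArg (fun p : Σ a : V, Σ b : V, Quiver.Path a b => p.2.2.length) h
    simp at h1
  · rw [ofPath_mul_ofPath_of_ne _ _ hc, map_zero, DualBimodule.map_zero]

theorem dualForm_nil_mul_arrow {x y : ExtQuiver I} (a : x ⟶ y) :
    TrivSqZeroExt.inr (dualForm I ⟨base I x, base I x, Path.nil⟩) *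
      canonical hI (ofPath K a.toPath) = 0 := by
  refine ext_arrow_cases (P := fun {x y} (a : x ⟶ y) =>
    TrivSqZeroExt.inr (dualForm I ⟨base I x, base I x, Path.nil⟩) *
      canonical hI (ofPath K a.toPath) = 0) ?_ ?_ a
  · intro x y a
    rw [← Prefunctor.mapPath_toPath, canonical_mapPath]
    have h1 := congrArg (TrivSqZeroExt.inr (R := BoundAlgebra I)) (op_smul_dualForm_nil hI a)
    exact (TrivSqZeroExt.inr_mul_inl (R := BoundAlgebra I) (M := DualBimodule K (BoundAlgebra I))
      _ _).trans (h1.trans (TrivSqZeroExt.inr_zero _))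
  · intro x y m hm
    rw [canonical_newArrow]
    exact inr_mul_inr_eq_zero _ _

/-- If `ab` were not in `I`, it would lie on a maximal path and so on a special cycle. -/
theorem canonical_old_old {x y z : V} (a : x ⟶ y) (b : y ⟶ z)
    (h : ∀ C ∈ specialCycles I,
      ¬ IsSubpath (((incl I).map a).toPath.comp ((incl I).map b).toPath) (closedPow C.2 1)) :
    canonical hI (ofPath K (((incl I).map a).toPath.comp ((incl I).map b).toPath)) = 0 := by
  have h1 : canonical hI (ofPath K (((incl I).map a).toPath.comp ((incl I).map b).toPath)) =
    TrivSqZeroExt.inl (toBound I (ofPath K (a.toPath.comp b.toPath))) :=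
    canonical_mapPath hI (a.toPath.comp b.toPath)
  rw [h1]
  by_cases hab : ofPath K (a.toPath.comp b.toPath) ∈ I
  · rw [toBound_eq_zero.2 hab, TrivSqZeroExt.inl_zero]
  · exfalso
    obtain ⟨x', y', r, s, hm⟩ := exists_maximal hI _ hab
    refine h _ (around_special hm (Path.comp_nil _).symm)
      ⟨(newArrow I _ hm).toPath.comp ((incl I).mapPath r), (incl I).mapPath s, ?_⟩
    have h2 : (incl I).mapPath (r.comp ((a.toPath.comp b.toPath).comp s)) =
        ((incl I).mapPath r).comp ((((incl I).map a).toPath.comp ((incl I).map b).toPath).comp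
          ((incl I).mapPath s)) := by
      rw [Prefunctor.mapPath_comp, Prefunctor.mapPath_comp]
      rfl
    refine (closedPow_one _).trans ((Path.nil_comp _).trans ?_)
    exact (congrArg _ h2).trans (Path.comp_assoc _ _ _).symm

/-- The image vanishes unless `a` is the last arrow of `m`, and then the pair lies on `m β_m`. -/
theorem canonical_old_new {w x y : V} (a : w ⟶ y) (m : Quiver.Path x y) (hm : IsMaximalPath I m)
    (h : ∀ C ∈ specialCycles I,
      ¬ IsSubpath (((incl I).map a).toPath.comp (newArrow I m hm).toPath) (closedPow C.2 1)) :
    canonical hI (ofPath K (((incl I).map a).toPath.comp (newArrow I m hm).toPath)) = 0 := by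
  refine canonical_around_eq_zero hI m hm a.toPath Path.nil fun z hz => ?_
  rw [Path.nil_comp] at hz
  refine h _ (around_special hm (Path.nil_comp _).symm) ⟨(incl I).mapPath z, Path.nil, ?_⟩
  have h2 : (incl I).mapPath m = ((incl I).mapPath z).comp ((incl I).map a).toPath := by
    rw [hz, Prefunctor.mapPath_comp, Prefunctor.mapPath_toPath]
  exact (closedPow_one _).trans ((congrArg (fun t => t.comp (newArrow I m hm).toPath) h2).trans
    (Path.comp_assoc _ _ _))

theorem canonical_new_old {x y z : V} (m : Quiver.Path x y) (hm : IsMaximalPath I m) (b : x ⟶ z)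
    (h : ∀ C ∈ specialCycles I,
      ¬ IsSubpath ((newArrow I m hm).toPath.comp ((incl I).map b).toPath) (closedPow C.2 1)) :
    canonical hI (ofPath K ((newArrow I m hm).toPath.comp ((incl I).map b).toPath)) = 0 := by
  have h1 : (newArrow I m hm).toPath.comp ((incl I).map b).toPath =
      around m hm Path.nil b.toPath := by
    rw [around, Prefunctor.mapPath_nil, Path.nil_comp, Prefunctor.mapPath_toPath]
  rw [h1]
  refine canonical_around_eq_zero hI m hm Path.nil b.toPath fun z hz => ?_
  rw [Path.comp_nil] at hz
  refine h _ (around_special hm (Path.comp_nil _).symm) ⟨Path.nil, (incl I).mapPath z, ?_⟩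
  have h2 : (incl I).mapPath m = ((incl I).map b).toPath.comp ((incl I).mapPath z) := by
    rw [hz, Prefunctor.mapPath_comp, Prefunctor.mapPath_toPath]
  refine (closedPow_one _).trans ((Path.nil_comp _).trans (Eq.trans ?_ (Path.nil_comp _).symm))
  exact (congrArg _ h2).trans (Path.comp_assoc _ _ _).symm

theorem canonical_new_new {x y z : V} (m : Quiver.Path x y) (hm : IsMaximalPath I m)
    (m' : Quiver.Path z x) (hm' : IsMaximalPath I m') :
    canonical hI (ofPath K ((newArrow I m hm).toPath.comp (newArrow I m' hm').toPath)) = 0 := by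
  rw [← ofPath_mul_ofPath, map_mul, canonical_newArrow, canonical_newArrow]
  exact inr_mul_inr_eq_zero _ _

theorem canonical_pair_eq_zero {x y z : ExtQuiver I} (a : x ⟶ y) (b : y ⟶ z)
    (h : ∀ C ∈ specialCycles I, ¬ IsSubpath (a.toPath.comp b.toPath) (closedPow C.2 1)) :
    canonical hI (ofPath K (a.toPath.comp b.toPath)) = 0 := by
  rcases a with a | ⟨m, hm⟩ <;> rcases b with b | ⟨m', hm'⟩
  · exact canonical_old_old hI a b h
  · exact canonical_old_new hI a m' hm' h
  · exact canonical_new_old hI m hm b h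
  · exact canonical_new_new hI m hm m' hm'

theorem relIdeal_le_ker : relIdeal I ≤ TwoSidedIdeal.ker (canonical hI) := by
  refine TwoSidedIdeal.span_le.2 ?_
  rintro x (⟨C, C', hC, hC'⟩ | ⟨C, hC, a, q, -⟩ | ⟨a, b, h⟩)
  · rw [SetLike.mem_coe, TwoSidedIdeal.mem_ker, map_sub, closedPow_one, closedPow_one, sub_eq_zero]
    exact (canonical_special hI C hC).trans (canonical_special hI C' hC').symm
  · rw [SetLike.mem_coe, TwoSidedIdeal.mem_ker, closedPow_one, ← ofPath_mul_ofPath, map_mul]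
    have h1 := canonical_special hI C hC
    exact (congrArg (· * _) h1).trans (dualForm_nil_mul_arrow hI a)
  · exact (TwoSidedIdeal.mem_ker _).2 (canonical_pair_eq_zero hI a b h)

theorem canonical_eq_zero {x : PathAlgebra K (ExtQuiver I)} (hx : x ∈ relIdeal I) :
    canonical hI x = 0 :=
  (TwoSidedIdeal.mem_ker _).1 (relIdeal_le_ker hI hx)

omit hI in
theorem sub_special_mem {v : ExtQuiver I} {C C' : Quiver.Path v v}
    (hC : (⟨v, C⟩ : ClosedPath (ExtQuiver I)) ∈ specialCycles I)
    (hC' : (⟨v, C'⟩ : ClosedPath (ExtQuiver I)) ∈ specialCycles I) :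
    ofPath K C - ofPath K C' ∈ relIdeal I := by
  have := mem_relIdeal (I := I) (.type1 (K := K) C C' hC hC')
  rwa [closedPow_one, closedPow_one] at this

/-- All complements of a path agree modulo the relations. -/
theorem around_sub_complement_mem {x y d c : V} (p : Quiver.Path x d) (z : Quiver.Path d c)
    (q : Quiver.Path c y) (m : Quiver.Path x y) (hm : IsMaximalPath I m)
    (h : m = p.comp (z.comp q)) :
    ofPath K (around m hm q p) - complement I ⟨d, c, z⟩ ∈ relIdeal I := by
  subst h
  have hz : ofPath K z ∉ I := fun hz => hm.1 (comp_mem_left _ (comp_mem_right _ hz))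
  obtain ⟨x', y', r, s, hm', h⟩ := complement_spec hI (p := ⟨d, c, z⟩) hz
  rw [h]
  -- For trivial `z` both complements are special cycles at one vertex, related by type 1; otherwise
  -- `z` has only one complement.
  by_cases h0 : arrows z = []
  · cases z with
    | cons z e => simp at h0
    | nil =>
      exact sub_special_mem (around_special hm (by rw [Path.nil_comp]))
        (around_special hm' (by rw [Path.nil_comp]))
  · obtain ⟨rfl, rfl⟩ := ends_eq_of_maximal hI h0 hm hm'
    obtain ⟨rfl, rfl⟩ := eq_of_maximal hI h0 hm hm'
    rw [sub_self]
    exact (relIdeal I).zero_mem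

theorem canonical_around_fst {x y c d : V} (m : Quiver.Path x y) (hm : IsMaximalPath I m)
    (q : Quiver.Path c y) (p : Quiver.Path x d) :
    (canonical hI (ofPath K (around m hm q p))).fst = 0 := by
  rw [canonical_around, TrivSqZeroExt.fst_inr]

/-- If `m = p z q`, the dual component is `z^∨` and the sum reduces to the complement of `z`;
otherwise the path is already in the ideal. -/
theorem around_sub_sum_mem {x y c d : V} (m : Quiver.Path x y) (hm : IsMaximalPath I m)
    (q : Quiver.Path c y) (p : Quiver.Path x d) :
    ofPath K (around m hm q p) - ∑ k ∈ nonzeroPaths hI,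
      (canonical hI (ofPath K (around m hm q p))).snd (toBound I (ofPath K k.2.2)) •
        complement I k ∈ relIdeal I := by
  rcases around_mem_or hI m hm q p with h | ⟨z, hz⟩
  · rw [canonical_eq_zero hI h]
    simpa using h
  · have hzI : ofPath K z ∉ I := fun h =>
      hm.1 (hz ▸ comp_mem_left _ (comp_mem_right _ h))
    rw [canonical_around_comp hI m hm q p z hz, TrivSqZeroExt.snd_inr,
      Finset.sum_eq_single ⟨d, c, z⟩, dualForm_toBound hI hzI, if_pos rfl, one_smul]
    · exact around_sub_complement_mem hI p z q m hm hz
    · intro k _ hk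
      rw [dualForm_toBound hI hzI, if_neg hk, zero_smul]
    · exact fun h => absurd ((mem_nonzeroPaths hI).2 hzI) h

/-- An element of the path algebra is determined modulo the relations by its image in the
trivial extension. -/
theorem sub_mem_relIdeal (x : PathAlgebra K (ExtQuiver I)) (x₀ : PathAlgebra K V)
    (hx : (canonical hI x).fst = toBound I x₀) :
    x - inclAlg I x₀ - ∑ p ∈ nonzeroPaths hI,
      (canonical hI x).snd (toBound I (ofPath K p.2.2)) • complement I p ∈ relIdeal I := by
  -- The lift `x₀` is arbitrary because two lifts differ by an element of `I`, which `inclAlg_mem`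
  -- sends into the relations.
  induction x using pathAlgebra_induction generalizing x₀ with
  | zero =>
    rw [map_zero, TrivSqZeroExt.fst_zero, eq_comm, toBound_eq_zero] at hx
    simpa using (relIdeal I).neg_mem (inclAlg_mem hI hx)
  | add x y ihx ihy =>
    obtain ⟨x₁, h₁⟩ := toBound_surjective I (canonical hI x).fst
    obtain ⟨y₁, h₂⟩ := toBound_surjective I (canonical hI y).fst
    rw [_root_.map_add, TrivSqZeroExt.fst_add, ← h₁, ← h₂, ← _root_.map_add, toBound_eq] at hx
    have := (relIdeal I).add_mem ((relIdeal I).add_mem (ihx x₁ h₁.symm) (ihy y₁ h₂.symm))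
      (inclAlg_mem hI hx)
    convert this using 1
    simp only [_root_.map_add, map_sub, TrivSqZeroExt.snd_add, DualBimodule.add_apply, add_smul,
      Finset.sum_add_distrib]
    abel
  | path r a b w =>
    have key : ∃ w₁, (canonical hI (ofPath K w)).fst = toBound I w₁ ∧
        ofPath K w - inclAlg I w₁ - ∑ p ∈ nonzeroPaths hI,
          (canonical hI (ofPath K w)).snd (toBound I (ofPath K p.2.2)) • complement I p ∈
            relIdeal I := by
      rcases ext_path_cases w with ⟨p, rfl⟩ | ⟨a, b, m, hm, q, p, rfl⟩ |
        ⟨a, b, a', b', m, hm, m', hm', p, r, s, rfl⟩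
      · have h1 := canonical_mapPath hI p
        refine ⟨ofPath K p, ?_, ?_⟩
        · erw [h1]
          rw [TrivSqZeroExt.fst_inl]
        · erw [h1]
          rw [TrivSqZeroExt.snd_inl, inclAlg_ofPath]
          erw [sub_self]
          simp
      · exact ⟨0, by rw [map_zero]; exact (canonical_around_fst hI m hm q p),
          by rw [map_zero, sub_zero]; exact around_sub_sum_mem hI m hm q p⟩
      · have h1 := comp_mem_left r (comp_mem_right s (new_old_new_mem hI m hm m' hm' p))
        refine ⟨0, ?_, ?_⟩
        · rw [canonical_eq_zero hI h1, TrivSqZeroExt.fst_zero, map_zero]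
        · rw [canonical_eq_zero hI h1]
          simpa using h1
    obtain ⟨w₁, h1, h2⟩ := key
    rw [_root_.map_smul, TrivSqZeroExt.fst_smul, h1, ← _root_.map_smul, toBound_eq] at hx
    have := (relIdeal I).add_mem (smul_mem_twoSidedIdeal r h2) (inclAlg_mem hI hx)
    convert this using 1
    simp only [_root_.map_smul, map_sub, TrivSqZeroExt.snd_smul, DualBimodule.smul_apply,
      smul_sub, Finset.smul_sum, smul_assoc]
    abel

theorem ker_canonical : TwoSidedIdeal.ker (canonical hI) = relIdeal I := by
  refine le_antisymm (fun x hx => ?_) (relIdeal_le_ker hI)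
  rw [TwoSidedIdeal.mem_ker] at hx
  have := sub_mem_relIdeal hI x 0 (by rw [hx, TrivSqZeroExt.fst_zero, map_zero])
  rw [hx] at this
  simpa using this

end Kernel

/-! ### Defining pair, admissible cut and admissibility of the relations. -/

section SpecialCycles

variable {K : Type w} [Field K] {V : Type u} [Quiver.{v} V] [Fintype V]
  {I : TwoSidedIdeal (PathAlgebra K V)}

theorem arrows_maximalCycle {x y : V} (m : Quiver.Path x y) (hm : IsMaximalPath I m) :
    arrows (maximalCycle I m hm).2 = beta I m hm :: (arrows m).map (inclArrow I) := by
  rw [maximalCycle, arrows_comp, arrows_newArrow, arrows_mapPath]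
  rfl

theorem arrows_special {C : ClosedPath (ExtQuiver I)} (hC : C ∈ specialCycles I) :
    ∃ (x y : V) (m : Quiver.Path x y) (hm : IsMaximalPath I m),
      arrows C.2 ~r beta I m hm :: (arrows m).map (inclArrow I) := by
  obtain ⟨x, y, m, hm, h⟩ := hC
  exact ⟨x, y, m, hm, by rw [← arrows_maximalCycle]; exact h.isRotated.symm⟩

theorem mem_specialCycles_of_isRotated {C : ClosedPath (ExtQuiver I)} {x y : V}
    {m : Quiver.Path x y} {hm : IsMaximalPath I m}
    (h : arrows C.2 ~r beta I m hm :: (arrows m).map (inclArrow I)) : C ∈ specialCycles I := by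
  refine ⟨x, y, m, hm, isCyclicPerm_of_isRotated ?_ ?_⟩
  · rw [arrows_maximalCycle]
    exact h.symm
  · rw [arrows_maximalCycle]
    simp

theorem maximalCycle_mem {x y : V} {m : Quiver.Path x y} (hm : IsMaximalPath I m) :
    maximalCycle I m hm ∈ specialCycles I :=
  mem_specialCycles_of_isRotated (by rw [arrows_maximalCycle])

theorem exists_special_beta {x y : V} (m : Quiver.Path x y) (hm : IsMaximalPath I m) :
    ∃ C ∈ specialCycles I, beta I m hm ∈ arrows C.2 :=
  ⟨maximalCycle I m hm, maximalCycle_mem hm, by simp [arrows_maximalCycle]⟩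

theorem arrows_special_ne_nil {C : ClosedPath (ExtQuiver I)} (hC : C ∈ specialCycles I) :
    arrows C.2 ≠ [] := by
  obtain ⟨x, y, m, hm, h⟩ := arrows_special hC
  intro h0
  rw [h0, List.isRotated_nil_iff'] at h
  simp at h

theorem specialCycles_isAdmissibleCut : IsAdmissibleCut (specialCycles I) (newArrows I) := by
  intro C hC
  obtain ⟨x, y, m, hm, h⟩ := arrows_special hC
  refine ⟨beta I m hm, ⟨⟨x, y, m, hm, rfl⟩, h.mem_iff.2 List.mem_cons_self⟩, ?_⟩
  rintro _ ⟨⟨x', y', m', hm', rfl⟩, h'⟩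
  rcases List.mem_cons.1 (h.mem_iff.1 h') with h' | h'
  · exact h'
  · exact absurd h' (beta_notMem_map m' hm' _)

/-- At a vertex whose trivial path is maximal there is only one special cycle, a loop. -/
theorem special_eq_of_isMaximalPath_nil {v : V}
    (hv : IsMaximalPath I (Path.nil : Quiver.Path v v))
    (C : Quiver.Path ((incl I).obj v) ((incl I).obj v))
    (hC : (⟨(incl I).obj v, C⟩ : ClosedPath (ExtQuiver I)) ∈ specialCycles I) :
    C = (newArrow I Path.nil hv).toPath := by
  obtain ⟨x, y, c, p, q, hm, h⟩ := mem_specialCycles.1 hC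
  obtain rfl : v = c := congrArg Sigma.fst h
  obtain rfl := eq_of_heq (Sigma.mk.inj h).2
  have hp : ofPath K p ∉ I := fun h => hm.1 (comp_mem_right _ h)
  have hq : ofPath K q ∉ I := fun h => hm.1 (comp_mem_left _ h)
  cases p with
  | cons p e => exact absurd (by simpa using hv.comp_mem' (p.cons e) (by simp)) hp
  | nil =>
    cases q with
    | cons q e => exact absurd (by simpa using hv.comp_mem (q.cons e) (by simp)) hq
    | nil => rfl

variable (hI : IsAlmostGentle I)
include hI

/-- A cycle `q β_m p` has one arrow more than `m`, so a loop comes from a trivial `m`. -/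
theorem special_of_length_one {v : V} (C : Quiver.Path ((incl I).obj v) ((incl I).obj v))
    (hC : (⟨(incl I).obj v, C⟩ : ClosedPath (ExtQuiver I)) ∈ specialCycles I)
    (h1 : C.length = 1) : IsMaximalPath I (Path.nil : Quiver.Path v v) := by
  obtain ⟨x, y, c, p, q, hm, h⟩ := mem_specialCycles.1 hC
  obtain rfl : v = c := congrArg Sigma.fst h
  obtain rfl := eq_of_heq (Sigma.mk.inj h).2
  rw [← length_arrows, arrows_around] at h1
  simp only [List.length_append, List.length_map, List.length_cons, length_arrows] at h1
  cases p with
  | cons p e => simp at h1; omega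
  | nil =>
    cases q with
    | cons q e => simp at h1
    | nil => simpa using hm

theorem exists_special_inclArrow {x y : V} (a : x ⟶ y) :
    ∃ C ∈ specialCycles I, inclArrow I ⟨x, y, a⟩ ∈ arrows C.2 := by
  obtain ⟨x', y', r, s, hm⟩ := exists_maximal hI _ (toPath_notMem hI a)
  refine ⟨maximalCycle I _ hm, maximalCycle_mem hm, ?_⟩
  rw [arrows_maximalCycle]
  exact List.mem_cons_of_mem _ (List.mem_map.2 ⟨⟨x, y, a⟩, by simp, rfl⟩)

theorem specialCycles_isDefiningPair
    (hV : ∀ x : V, ∃ y : V, Nonempty (x ⟶ y) ∨ Nonempty (y ⟶ x)) :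
    IsDefiningPair (specialCycles I) (fun _ => 1) where
  simple C hC := by
    obtain ⟨x, y, m, hm, h⟩ := arrows_special hC
    refine ⟨?_, ?_⟩
    · rw [← length_arrows]
      exact List.length_pos_iff.2 (arrows_special_ne_nil hC)
    · rw [h.nodup_iff, List.nodup_cons]
      exact ⟨beta_notMem_map m hm _, (hm.nodup hI).map inclArrow_injective⟩
  pos _ _ := one_pos
  d0 C hC h1 := by
    -- A special loop makes the trivial path maximal, but an arrow at its vertex would extend it;
    -- this is the only place where `hV` is needed.
    exfalso
    have hv := special_of_length_one hI (v := base I C.1) C.2 hC h1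
    obtain ⟨y, ⟨⟨a⟩⟩ | ⟨⟨a⟩⟩⟩ := hV (base I C.1)
    · exact toPath_notMem hI a (Path.nil_comp a.toPath ▸ hv.comp_mem a.toPath (by simp))
    · exact toPath_notMem hI a (by simpa using hv.comp_mem' a.toPath (by simp))
  d1 C hC C' h := by
    obtain ⟨x, y, m, hm, hr⟩ := arrows_special hC
    exact mem_specialCycles_of_isRotated (h.isRotated.symm.trans hr)
  d2 _ _ _ _ := rfl
  d3 e := by
    obtain ⟨x, y, a | ⟨m, hm⟩⟩ := e
    · exact exists_special_inclArrow hI (show base I x ⟶ base I y from a)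
    · exact exists_special_beta (x := base I y) (y := base I x) m hm
  d4 C hC C' hC' e he he' := by
    obtain ⟨x, y, m, hm, hr⟩ := arrows_special hC
    obtain ⟨x', y', m', hm', hr'⟩ := arrows_special hC'
    -- A common new arrow names its maximal path; a common old arrow lies on both maximal paths,
    -- which then agree.
    have key : (⟨x, y, m⟩ : Σ x : V, Σ y : V, Quiver.Path x y) = ⟨x', y', m'⟩ := by
      rw [hr.mem_iff, List.mem_cons] at he
      rw [hr'.mem_iff, List.mem_cons] at he'
      rcases he with rfl | he
      · rcases he' with h | h
        · obtain ⟨rfl, rfl⟩ := beta_ends h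
          rw [beta_inj h]
        · exact absurd h (beta_notMem_map m hm _)
      · rcases he' with rfl | he'
        · exact absurd he (beta_notMem_map m' hm' _)
        · obtain ⟨a, ha, rfl⟩ := List.mem_map.1 he
          rw [List.mem_map_of_injective inclArrow_injective] at he'
          have h := hm.arrows_eq hI hm' ha he'
          obtain ⟨rfl, rfl⟩ := ends_eq_of_arrows_eq m m' h (List.ne_nil_of_mem ha)
          rw [arrows_injective h]
    cases key
    exact isCyclicPerm_of_isRotated (hr.trans hr'.symm) (arrows_special_ne_nil hC)

/-- Only type 1 relations could involve paths of length one. Special loops exist only at isolated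
vertices, where the special cycle is unique and the difference is zero. -/
theorem relIdeal_le_arrowIdealPow : relIdeal I ≤ arrowIdealPow K (ExtQuiver I) 2 := by
  refine TwoSidedIdeal.span_le.2 ?_
  rintro x (⟨C, C', hC, hC'⟩ | ⟨C, hC, a, q, -⟩ | ⟨a, b, h⟩)
  · rw [SetLike.mem_coe, closedPow_one, closedPow_one]
    have h1 : 0 < C.length := by
      rw [← length_arrows]
      exact List.length_pos_iff.2 (arrows_special_ne_nil hC)
    have h2 : 0 < C'.length := by
      rw [← length_arrows]
      exact List.length_pos_iff.2 (arrows_special_ne_nil hC')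
    by_cases hlen : 2 ≤ C.length ∧ 2 ≤ C'.length
    · exact (arrowIdealPow K _ 2).sub_mem (ofPath_mem_arrowIdealPow _ hlen.1)
        (ofPath_mem_arrowIdealPow _ hlen.2)
    · rename_i v
      have hv : IsMaximalPath I (Path.nil : Quiver.Path (base I v) (base I v)) := by
        by_cases h3 : 2 ≤ C.length
        · have h4 : C'.length = 1 := by omega
          exact special_of_length_one hI C' hC' h4
        · have h4 : C.length = 1 := by omega
          exact special_of_length_one hI C hC h4
      have h3 := special_eq_of_isMaximalPath_nil hv C hC
      have h4 := special_eq_of_isMaximalPath_nil hv C' hC'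
      have h5 : C = C' := h3.trans h4.symm
      rw [h5, sub_self]
      exact (arrowIdealPow K _ 2).zero_mem
  · rw [SetLike.mem_coe, closedPow_one]
    have h1 := List.length_pos_iff.2 (arrows_special_ne_nil hC)
    rw [length_arrows] at h1
    refine ofPath_mem_arrowIdealPow _ ?_
    rw [Path.length_comp, Path.length_toPath]
    exact Nat.succ_le_succ h1
  · exact ofPath_mem_arrowIdealPow _ le_rfl

theorem isAdmissible_relIdeal : IsAdmissible (relIdeal I) := by
  obtain ⟨N, hN⟩ := exists_length_bound hI
  -- A path of this length with at most one new arrow has a stretch of at least `N` old arrows; the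
  -- summand `2` also guarantees an exponent of at least two.
  refine ⟨2 * N + 2, by omega, TwoSidedIdeal.span_le.2 ?_, relIdeal_le_arrowIdealPow hI⟩
  rintro _ ⟨x, y, w, hw, rfl⟩
  rw [SetLike.mem_coe]
  have hN' : ∀ {a b : V} (p : Quiver.Path a b), N ≤ p.length → ofPath K p ∈ I :=
    fun p hp => by_contra fun h => absurd (hN _ _ p h) (by omega)
  rcases ext_path_cases w with ⟨p, rfl⟩ | ⟨a, b, m, hm, q, p, rfl⟩ |
    ⟨a, b, a', b', m, hm, m', hm', p, r, s, rfl⟩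
  · refine mapPath_mem hI (hN' p ?_)
    have h1 : ((incl I).mapPath p).length = 2 * N + 2 := hw
    rw [← length_arrows, arrows_mapPath, List.length_map, length_arrows] at h1
    omega
  · have h1 : (around m hm q p).length = 2 * N + 2 := hw
    rw [← length_arrows, arrows_around] at h1
    simp only [List.length_append, List.length_map, List.length_cons, length_arrows] at h1
    by_cases hq : N ≤ q.length
    · exact comp_mem_right _ (mapPath_mem hI (hN' q hq))
    · exact comp_mem_left _ (comp_mem_left _ (mapPath_mem hI (hN' p (by omega))))
  · exact comp_mem_left r (comp_mem_right s (new_old_new_mem hI m hm m' hm' p))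

end SpecialCycles

/-! ### The cut algebra. -/

section Cut

variable {K : Type w} [Field K] {V : Type u} [Quiver.{v} V] [Fintype V]
  {I : TwoSidedIdeal (PathAlgebra K V)} (hI : IsAlmostGentle I)
include hI

/-- The composite of the canonical map with the projection of the trivial extension. -/
noncomputable def canonicalFst : PathAlgebra K (ExtQuiver I) →ₐ[K] BoundAlgebra I :=
  (TrivSqZeroExt.fstHom K (BoundAlgebra I) (DualBimodule K (BoundAlgebra I))).comp (canonical hI)

theorem canonicalFst_apply (x : PathAlgebra K (ExtQuiver I)) :
    canonicalFst hI x = (canonical hI x).fst := rfl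

theorem complement_mem_cutIdeal {p : Σ a : V, Σ b : V, Quiver.Path a b}
    (hp : ofPath K p.2.2 ∉ I) (J : TwoSidedIdeal (PathAlgebra K (ExtQuiver I))) :
    complement I p ∈ cutIdeal J (newArrows I) := by
  obtain ⟨x, y, r, s, hm, h⟩ := complement_spec hI hp
  rw [h]
  refine comp_mem_left _ (comp_mem_right _ ?_)
  exact TwoSidedIdeal.subset_span (Or.inr ⟨_, ⟨x, y, _, hm, rfl⟩, rfl⟩)

theorem mem_cutIdeal_iff (x : PathAlgebra K (ExtQuiver I)) :
    x ∈ cutIdeal (TwoSidedIdeal.ker (canonical hI)) (newArrows I) ↔ canonicalFst hI x = 0 := by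
  constructor
  · intro hx
    rw [← TwoSidedIdeal.mem_ker]
    refine TwoSidedIdeal.span_le.2 ?_ hx
    rintro y (hy | ⟨_, ⟨x', y', m, hm, rfl⟩, rfl⟩)
    · rw [SetLike.mem_coe, TwoSidedIdeal.mem_ker, canonicalFst_apply,
        (TwoSidedIdeal.mem_ker _).1 hy, TrivSqZeroExt.fst_zero]
    · rw [SetLike.mem_coe, TwoSidedIdeal.mem_ker, canonicalFst_apply, canonical_newArrow,
        TrivSqZeroExt.fst_inr]
  · intro hx
    rw [canonicalFst_apply] at hx
    have hsum := canonical_sum_complement hI (canonical hI x).snd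
    -- The element `s` has the same image as `x`, whose `A`-component is zero, so `x - s` is in the
    -- kernel; and `s` is built from paths through new arrows.
    set s := ∑ p ∈ nonzeroPaths hI,
      (canonical hI x).snd (toBound I (ofPath K p.2.2)) • complement I p
    rw [← sub_add_cancel x s]
    refine TwoSidedIdeal.add_mem _ (TwoSidedIdeal.subset_span (Or.inl ?_)) ?_
    · refine (TwoSidedIdeal.mem_ker _).2 ?_
      rw [map_sub, hsum]
      ext
      · rw [TrivSqZeroExt.fst_sub, hx, TrivSqZeroExt.fst_inr, sub_zero, TrivSqZeroExt.fst_zero]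
      · rw [TrivSqZeroExt.snd_sub, TrivSqZeroExt.snd_inr, sub_self, TrivSqZeroExt.snd_zero]
    · refine sum_mem fun p hp => smul_mem_twoSidedIdeal _ ?_
      exact complement_mem_cutIdeal hI ((mem_nonzeroPaths hI).1 hp) _

theorem canonicalFst_surjective : Function.Surjective (canonicalFst hI) := by
  intro a
  obtain ⟨x, hx⟩ := canonical_surjective hI (TrivSqZeroExt.inl a)
  exact ⟨x, by rw [canonicalFst_apply, hx, TrivSqZeroExt.fst_inl]⟩

/-- The cut algebra of the trivial extension is the original algebra. -/
theorem nonempty_cutAlgebra_equiv :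
    Nonempty (CutAlgebra (TwoSidedIdeal.ker (canonical hI)) (newArrows I) ≃ₐ[K]
      BoundAlgebra I) := by
  set J := cutIdeal (TwoSidedIdeal.ker (canonical hI)) (newArrows I)
  have hJ : J.ringCon ≤ RingCon.ker (canonicalFst hI).toRingHom := by
    intro x y h
    rw [TwoSidedIdeal.rel_iff, mem_cutIdeal_iff, map_sub, sub_eq_zero] at h
    exact h
  refine ⟨AlgEquiv.ofBijective (RingCon.liftₐ J.ringCon (canonicalFst hI) hJ) ⟨?_, ?_⟩⟩
  · rw [injective_iff_map_eq_zero]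
    intro a ha
    obtain ⟨x, rfl⟩ := toBound_surjective J a
    rw [toBound_eq_zero]
    exact (mem_cutIdeal_iff hI x).2 ha
  · intro a
    obtain ⟨x, rfl⟩ := canonicalFst_surjective hI a
    exact ⟨toBound J x, rfl⟩

end Cut

end AlmostGentle

open AlmostGentle
/-- For an almost gentle algebra `A = KQ/I`: the canonical map presents `T(A)` by the quiver `Q` with
one new arrow `β_m` for each maximal path `m`, with an admissible ideal of relations, as the algebra
defined by the cycles `m β_m` with multiplicity one (a defining pair if `Q` has no isolated vertex);
the set of new arrows is an admissible cut, and its cut algebra is isomorphic to `A`. -/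
theorem theorem5p3 {K : Type*} [Field K] {V : Type*} [Quiver V] [Fintype V]
    (I : TwoSidedIdeal (PathAlgebra K V)) (hI : IsAlmostGentle I) :
    ((∀ x : V, ∃ y : V, Nonempty (x ⟶ y) ∨ Nonempty (y ⟶ x)) →
      IsDefiningPair (specialCycles I) (fun _ => 1)) ∧
    ∃ φ : PathAlgebra K (ExtQuiver I) →ₐ[K] TrivialExtension K (BoundAlgebra I),
      IsCanonical I φ ∧
      Function.Surjective φ ∧
      IsAdmissible (TwoSidedIdeal.ker φ) ∧
      TwoSidedIdeal.ker φ = cycleIdeal K (specialCycles I) (fun _ => 1) ∧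
      IsAdmissibleCut (specialCycles I) (newArrows I) ∧
      Nonempty (CutAlgebra (TwoSidedIdeal.ker φ) (newArrows I) ≃ₐ[K] BoundAlgebra I) := by
  refine ⟨specialCycles_isDefiningPair hI, canonical hI, canonical_isCanonical hI,
    canonical_surjective hI, ?_, ker_canonical hI, specialCycles_isAdmissibleCut,
    nonempty_cutAlgebra_equiv hI⟩
  rw [ker_canonical hI]
  exact isAdmissible_relIdeal hI
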